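/- Let $R$ be a commutative Noetherian ring of finite global (homological) dimension; "sheaf" means sheaf of $R$-modules. Let $X$ be a topological space of finite homological dimension, i.e. there is an $n$ with $H^i(X,\mathcal F)=0$ for all $i>n$ and all sheaves $\mathcal F$ on $X$. A *stratification* of $X$ is a finite partition $\mathcal S$ of $X$ into non-empty locally closed subsets (strata), each of which is a simply connected topological manifold, such that the closure of every stratum is a union of strata. The *star* of $S\in\mathcal S$ is the open set $\mathrm{Et}_S=\bigcup_{T\in\mathcal S,\,S\subset\overline T}T$. A sheaf is *weakly constructible* if its restriction to every stratum is a constant sheaf, and *constructible* if moreover all its stalks are finitely generated. $\mathcal S$ is *acyclic* if for every weakly constructible sheaf $\mathcal F$ and every $S\in\mathcal S$ the natural map $\Gamma(\mathrm{Et}_S,\mathcal F)\to\mathcal F_x$ is an isomorphism for all $x\in S$, and $H^i(\mathrm{Et}_S,\mathcal F)=0$ for all $i>0$. For $*=+,b$ let $D^*_{w,c}(X)$ (respectively $D^*_c(X)$) be the full subcategory of $D^*(X)$, the bounded below (respectively bounded) derived category of sheaves on $X$, of those complexes all of whose cohomology sheaves are weakly constructible (respectively constructible). Let $Q_{\mathcal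 S}$ be the quiver whose vertices are the strata, with exactly one arrow $S\to T$ if $S\subset\overline T$ and none otherwise, and let $\rho_{\mathcal S}$ be the set of relations that identify any two paths (including paths of length $0$) with the same source and the same target. Let $\operatorname{Rep}(Q_{\mathcal S},\rho_{\mathcal S})$ be the category of representations of $Q_{\mathcal S}$ in $R$-modules that satisfy these relations, and $\operatorname{Rep_f}(Q_{\mathcal S},\rho_{\mathcal S})$ its full subcategory of representations with finitely generated stalks. Let $\Phi$ be the functor from sheaves on $X$ to $\operatorname{Rep}(Q_{\mathcal S},\rho_{\mathcal S})$ that sends $\mathcal F$ to $(\Gamma(\mathrm{Et}_S,\mathcal F))_{S\in\mathcal S}$ with the restriction maps, and $R\Phi: D^+(X)\to D^+(\operatorname{Rep}(Q_{\mathcal S},\rho_{\mathcal S}))$ its right derived functor. **Theorem.** Suppose that $\mathcal S$ is an acyclic stratification of $X$. Then the restriction of $R\Phi$ is an equivalence $$D^+_{w,c}(X)\xrightarrow{\ \sim\ }D^+(\operatorname{Rep}(Q_{\mathcal S},\rho_{\mathcal S})),$$ and it induces equivalences $$D^b_{w,c}(X)\xrightarrow{\ \sim\ }D^b(\operatorname{Rep}(Q_{\mathcal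 S},\rho_{\mathcal S})),\qquad D^b_c(X)\xrightarrow{\ \sim\ }D^b(\operatorname{Rep_f}(Q_{\mathcal S},\rho_{\mathcal S})),$$ the last one in the sense that its composite with the functor to $D(\operatorname{Rep}(Q_{\mathcal S},\rho_{\mathcal S}))$ induced by the exact inclusion $\operatorname{Rep_f}(Q_{\mathcal S},\rho_{\mathcal S})\subset\operatorname{Rep}(Q_{\mathcal S},\rho_{\mathcal S})$ is isomorphic to the restriction of $R\Phi$. -/

import Mathlib

open CategoryTheory CategoryTheory.Limits TopologicalSpace Opposite

universe u w₁ w₂ w₃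

noncomputable section

/-! ### Representations of quivers with relations -/

namespace QuiverRep

/-- A relation in a quiver `Q`: an `R`-linear combination of paths with the same source and the
same target. (The morphisms of `Paths Q` are the paths in `Q`, including those of length `0`.) -/
structure Relation (R : Type u) [CommRing R] (Q : Type u) [Quiver.{0} Q] where
  /-- the common source of the paths -/
  src : Paths Q
  /-- the common target of the paths -/
  tgt : Paths Q
  /-- the coefficients of the paths -/
  coeff : (src ⟶ tgt) →₀ R

/-- The category `Rep Q` of representations of `Q` in `R`-modules. A representation (a module for
each vertex and a linear map for each arrow) is the same as a functor on the category of paths, and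
maps of representations are natural transformations. -/
abbrev Rep (R : Type u) [CommRing R] (Q : Type u) [Quiver.{0} Q] :=
  Paths Q ⥤ ModuleCat.{u} R

variable {R : Type u} [CommRing R] {Q : Type u} [Quiver.{0} Q]

/-- The linear map by which the linear combination of paths `r` acts on the representation `V`. -/
def actRelation (V : Rep R Q) (r : Relation R Q) : V.obj r.src ⟶ V.obj r.tgt :=
  r.coeff.sum fun p c ↦ c • V.map p

/-- The representations that are compatible with all the relations in `ρ`. -/
def satisfies (ρ : Set (Relation R Q)) : ObjectProperty (Rep R Q) :=
  fun V ↦ ∀ r ∈ ρ, actRelation V r = 0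

/-- The category `Rep(Q, ρ)`, a full subcategory of `Rep Q`. -/
abbrev RepRel (ρ : Set (Relation R Q)) := (satisfies ρ).FullSubcategory

/-- The representations in `Rep(Q, ρ)` all of whose stalks are finitely generated. -/
def finiteStalks (ρ : Set (Relation R Q)) : ObjectProperty (RepRel ρ) :=
  fun V ↦ ∀ x : Paths Q, Module.Finite R (V.obj.obj x)

/-- The category `Rep_f(Q, ρ)`, a full subcategory of `Rep(Q, ρ)`. -/
abbrev RepRelFin (ρ : Set (Relation R Q)) := (finiteStalks ρ).FullSubcategory

/-! The categories `Rep(Q, ρ)` and, for Noetherian `R`, `Rep_f(Q, ρ)` are abelian. -/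

lemma actRelation_naturality {V W : Rep R Q} (f : V ⟶ W) (r : Relation R Q) :
    actRelation V r ≫ f.app _ = f.app _ ≫ actRelation W r := by
  simp only [actRelation, Finsupp.sum, Preadditive.sum_comp, Preadditive.comp_sum,
    Linear.smul_comp, Linear.comp_smul, f.naturality]

instance (ρ : Set (Relation R Q)) : (satisfies ρ).IsClosedUnderSubobjects where
  prop_of_mono {V W} f _ hW r hr := by
    rw [← cancel_mono (f.app r.tgt), actRelation_naturality, hW r hr]
    simp

instance (ρ : Set (Relation R Q)) : (satisfies ρ).IsClosedUnderQuotients where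
  prop_of_epi {V W} f _ hV r hr := by
    rw [← cancel_epi (f.app r.src), ← actRelation_naturality, hV r hr]
    simp

instance (ρ : Set (Relation R Q)) : (satisfies ρ).ContainsZero where
  exists_zero := by
    obtain ⟨Z, hZ⟩ := HasZeroObject.zero (C := Rep R Q)
    exact ⟨Z, hZ, fun r _ ↦ (((evaluation _ _).obj r.src).map_isZero hZ).eq_of_src _ _⟩

instance (ρ : Set (Relation R Q)) : (satisfies ρ).IsClosedUnderFiniteProducts where
  isClosedUnderLimitsOfShape J _ :=
    { limitsOfShape_le := by
        rintro V ⟨h⟩ r hr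
        refine (isLimitOfPreserves ((evaluation _ _).obj r.tgt) h.isLimit).hom_ext fun j ↦ ?_
        have := actRelation_naturality (h.π.app j) r
        rw [h.prop_diag_obj j r hr] at this
        simpa using this }

instance (ρ : Set (Relation R Q)) : Abelian (RepRel ρ) := inferInstance

/-- The functor that takes the stalk at the vertex `x`. -/
abbrev stalk (ρ : Set (Relation R Q)) (x : Paths Q) : RepRel ρ ⥤ ModuleCat.{u} R :=
  (satisfies ρ).ι ⋙ (evaluation _ _).obj x

instance (ρ : Set (Relation R Q)) : (satisfies ρ).ι.PreservesMonomorphisms :=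
  (satisfies ρ).preservesMonomorphisms_ι_of_isNormalEpiCategory

instance (ρ : Set (Relation R Q)) : (satisfies ρ).ι.PreservesEpimorphisms :=
  (satisfies ρ).preservesEpimorphisms_ι_of_isNormalMonoCategory

instance [IsNoetherianRing R] (ρ : Set (Relation R Q)) :
    (finiteStalks ρ).IsClosedUnderSubobjects where
  prop_of_mono {V W} f _ hW x := by
    have : Module.Finite R ((stalk ρ x).obj W) := hW x
    have hf : Mono ((stalk ρ x).map f) := inferInstance
    exact Module.Finite.of_injective ((stalk ρ x).map f).hom
      ((ModuleCat.mono_iff_injective _).1 hf)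

instance (ρ : Set (Relation R Q)) : (finiteStalks ρ).IsClosedUnderQuotients where
  prop_of_epi {V W} f _ hV x := by
    have : Module.Finite R ((stalk ρ x).obj V) := hV x
    have hf : Epi ((stalk ρ x).map f) := inferInstance
    exact Module.Finite.of_surjective ((stalk ρ x).map f).hom
      ((ModuleCat.epi_iff_surjective _).1 hf)

instance (ρ : Set (Relation R Q)) : (finiteStalks ρ).ContainsZero where
  exists_zero := by
    obtain ⟨Z, hZ⟩ := HasZeroObject.zero (C := RepRel ρ)
    refine ⟨Z, hZ, fun x ↦ ?_⟩
    have : Subsingleton ((stalk ρ x).obj Z) :=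
      ModuleCat.isZero_iff_subsingleton.1 ((stalk ρ x).map_isZero hZ)
    exact inferInstanceAs (Module.Finite R ((stalk ρ x).obj Z))

instance (ρ : Set (Relation R Q)) : (satisfies ρ).ι.PreservesHomology where
  preservesKernels _ _ f := (satisfies ρ).preservesKernels_ι f
  preservesCokernels _ _ f := (satisfies ρ).preservesCokernels_ι f

instance (ρ : Set (Relation R Q)) : PreservesFiniteLimits (satisfies ρ).ι :=
  (satisfies ρ).ι.preservesFiniteLimits_of_preservesHomology

instance [IsNoetherianRing R] (ρ : Set (Relation R Q)) :
    (finiteStalks ρ).IsClosedUnderFiniteProducts where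
  isClosedUnderLimitsOfShape J _ :=
    { limitsOfShape_le := by
        rintro V ⟨h⟩ x
        have hl := isLimitOfPreserves (stalk ρ x) h.isLimit
        have (j : J) : Module.Finite R ((stalk ρ x).obj (h.diag.obj ⟨j⟩)) :=
          h.prop_diag_obj ⟨j⟩ x
        let φ : (stalk ρ x).obj V →ₗ[R] (∀ j : J, (stalk ρ x).obj (h.diag.obj ⟨j⟩)) :=
          LinearMap.pi fun j ↦ ((stalk ρ x).map (h.π.app ⟨j⟩)).hom
        refine Module.Finite.of_injective φ fun a b hab ↦ ?_
        exact Concrete.isLimit_ext _ hl _ _ fun j ↦ congr_fun hab j.as }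

instance [IsNoetherianRing R] (ρ : Set (Relation R Q)) : Abelian (RepRelFin ρ) := inferInstance

instance [IsNoetherianRing R] (ρ : Set (Relation R Q)) :
    (finiteStalks ρ).ι.PreservesHomology where
  preservesKernels _ _ f := (finiteStalks ρ).preservesKernels_ι f
  preservesCokernels _ _ f := (finiteStalks ρ).preservesCokernels_ι f

instance [IsNoetherianRing R] (ρ : Set (Relation R Q)) :
    PreservesFiniteLimits (finiteStalks ρ).ι :=
  (finiteStalks ρ).ι.preservesFiniteLimits_of_preservesHomology

instance [IsNoetherianRing R] (ρ : Set (Relation R Q)) :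
    PreservesFiniteColimits (finiteStalks ρ).ι :=
  (finiteStalks ρ).ι.preservesFiniteColimits_of_preservesHomology

end QuiverRep

/-! ### Sheaves of `R`-modules and their cohomology -/

namespace SheafMod

variable (R : Type u) [CommRing R] {X : TopCat.{u}}

/-- The category of sheaves of `R`-modules on `X`. -/
abbrev Sh (X : TopCat.{u}) := X.Sheaf (ModuleCat.{u} R)

/-- The functor of sections `Γ(U, -)`. -/
abbrev sections (U : Opens X) : Sh R X ⥤ ModuleCat.{u} R :=
  TopCat.Sheaf.forget _ X ⋙ (evaluation _ _).obj (op U)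

instance (U : Opens X) : (sections R U).Additive where
  map_add := rfl

/-- Sheaf cohomology `Hⁱ(U, -)`: the `i`-th right derived functor of `Γ(U, -)`. -/
abbrev cohomology (U : Opens X) (i : ℕ) : Sh R X ⥤ ModuleCat.{u} R :=
  (sections R U).rightDerived i

/-- `X` has finite homological dimension (for sheaves of `R`-modules): there is an `n` such that
`Hⁱ(X, F) = 0` for all `i > n` and all sheaves `F` of `R`-modules. -/
def FiniteHomologicalDimension (X : TopCat.{u}) : Prop :=
  ∃ n : ℕ, ∀ i > n, ∀ F : Sh R X, IsZero ((cohomology R (⊤ : Opens X) i).obj F)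

end SheafMod

/-- The ring `R` has finite homological (i.e. global) dimension. -/
def RingFiniteHomologicalDimension (R : Type u) [CommRing R] : Prop :=
  ∃ n : ℕ, ∀ M : ModuleCat.{u} R, HasProjectiveDimensionLE M n

/-! ### Stratifications and constructible sheaves -/

/-- A topological manifold: a Hausdorff space that is locally homeomorphic to `ℝⁿ`. -/
def IsTopologicalManifold (M : Type u) [TopologicalSpace M] : Prop :=
  T2Space M ∧ ∃ n : ℕ, Nonempty (ChartedSpace (EuclideanSpace ℝ (Fin n)) M)

/-- A finite stratification of `X` into locally closed, simply connected topological manifolds,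
such that the closure of any stratum is a union of strata. -/
structure Stratification (X : TopCat.{u}) where
  /-- the set of strata -/
  strata : Set (Set X)
  finite : strata.Finite
  isPartition : Setoid.IsPartition strata
  isManifold : ∀ S ∈ strata, IsTopologicalManifold S
  simplyConnected : ∀ S ∈ strata, SimplyConnectedSpace S
  isLocallyClosed : ∀ S ∈ strata, IsLocallyClosed S
  closure_eq_sUnion : ∀ S ∈ strata, ∃ A ⊆ strata, closure S = ⋃₀ A

namespace Stratification

open SheafMod QuiverRep

variable {X : TopCat.{u}} (𝒮 : Stratification X)

/-- The star of a stratum `S`: the union of all strata whose closure contains `S`. -/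
def starSet (S : Set X) : Set X := ⋃₀ {T ∈ 𝒮.strata | S ⊆ closure T}

lemma isOpen_starSet (S : Set X) : IsOpen (𝒮.starSet S) := by
  have key : (𝒮.starSet S)ᶜ = ⋃ T ∈ {T ∈ 𝒮.strata | ¬ S ⊆ closure T}, closure T := by
    ext x
    simp only [starSet, Set.mem_compl_iff, Set.mem_sUnion, Set.mem_ofPred_eq, Set.mem_iUnion,
      exists_prop, not_exists, not_and]
    constructor
    · intro hx
      obtain ⟨T, ⟨hT, hxT⟩, -⟩ := 𝒮.isPartition.2 x
      exact ⟨T, ⟨hT, fun h ↦ hx T ⟨hT, h⟩ hxT⟩, subset_closure hxT⟩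
    · rintro ⟨T, ⟨hT, hST⟩, hxT⟩ T' ⟨hT', hST'⟩ hxT'
      obtain ⟨A, hA, hTA⟩ := 𝒮.closure_eq_sUnion T hT
      obtain ⟨T'', hT'', hx''⟩ : x ∈ ⋃₀ A := hTA ▸ hxT
      have h : T' = T'' := (𝒮.isPartition.2 x).unique ⟨hT', hxT'⟩ ⟨hA hT'', hx''⟩
      have hsub : T' ⊆ closure T := by
        rw [hTA, h]
        exact Set.subset_sUnion_of_mem hT''
      exact hST (hST'.trans (closure_minimal hsub isClosed_closure))
  rw [← isClosed_compl_iff, key]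
  exact (𝒮.finite.subset (Set.sep_subset _ _)).isClosed_biUnion fun T _ ↦ isClosed_closure

/-- The vertices of the quiver of strata: the strata. -/
def Vertex : Type u := 𝒮.strata

/-- There is exactly one arrow from `S` to `T` if `S ⊆ closure T`, and none otherwise. -/
instance : Quiver.{0} 𝒮.Vertex where
  Hom S T := PLift (S.1 ⊆ closure T.1)

/-- The star of a stratum, as an open subset of `X`. -/
def star (S : 𝒮.Vertex) : Opens X := ⟨𝒮.starSet S.1, 𝒮.isOpen_starSet S.1⟩

lemma mem_star {S : 𝒮.Vertex} {x : X} (hx : x ∈ S.1) : x ∈ 𝒮.star S :=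
  Set.mem_sUnion_of_mem hx ⟨S.2, subset_closure⟩

lemma star_le {S T : 𝒮.Vertex} (h : S.1 ⊆ closure T.1) : 𝒮.star T ≤ 𝒮.star S := by
  rintro x ⟨T', ⟨hT', hTT'⟩, hx⟩
  exact ⟨T', ⟨hT', h.trans (closure_minimal hTT' isClosed_closure)⟩, hx⟩

section

variable (R : Type u) [CommRing R]

/-- The relations on the quiver of strata that identify any two parallel paths. -/
def relations : Set (Relation R 𝒮.Vertex) :=
  {r | ∃ (S T : Paths 𝒮.Vertex) (p q : S ⟶ T),
    r = ⟨S, T, Finsupp.single p 1 - Finsupp.single q 1⟩}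

/-- The category of representations of the quiver of strata with relations. -/
abbrev RepStrata := RepRel (𝒮.relations R)

/-- The category of representations with finitely generated stalks of the quiver of strata with
relations. -/
abbrev RepStrataFin := RepRelFin (𝒮.relations R)

variable {R} in
/-- A sheaf is weakly constructible if its restriction to every stratum is a constant sheaf. -/
def weaklyConstructible : ObjectProperty (Sh R X) := fun F ↦ ∀ S ∈ 𝒮.strata,
  Sheaf.IsConstant (Opens.grothendieckTopology (TopCat.of S))
    ((TopCat.Sheaf.pullback (ModuleCat.{u} R)
      (TopCat.ofHom (⟨Subtype.val, continuous_subtype_val⟩ : C(S, X)))).obj F)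

variable {R} in
/-- A sheaf is constructible if it is weakly constructible and all its stalks are finitely
generated. -/
def constructible : ObjectProperty (Sh R X) := fun F ↦
  𝒮.weaklyConstructible F ∧ ∀ x : X, Module.Finite R (F.presheaf.stalk x)

/-- A stratification is acyclic (over `R`) if for every weakly constructible sheaf `F` and every
stratum `S` the map `Γ(star S, F) ⟶ Fₓ` is an isomorphism for all `x ∈ S`, and
`Hⁱ(star S, F) = 0` for all `i > 0`. -/
structure IsAcyclic : Prop where
  isIso_germ : ∀ F : Sh R X, 𝒮.weaklyConstructible F → ∀ (S : 𝒮.Vertex) (x : X) (hx : x ∈ S.1),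
    IsIso (F.presheaf.germ (𝒮.star S) x (𝒮.mem_star hx))
  isZero_cohomology : ∀ F : Sh R X, 𝒮.weaklyConstructible F → ∀ (S : 𝒮.Vertex), ∀ i > 0,
    IsZero ((cohomology R (𝒮.star S) i).obj F)

/-- The stars, as a functor on the path category of the quiver of strata. -/
def starFunctor : Paths 𝒮.Vertex ⥤ (Opens X)ᵒᵖ :=
  Paths.lift
    { obj := fun S ↦ op (𝒮.star S)
      map := fun {_ _} f ↦ (homOfLE (𝒮.star_le f.down)).op }

/-- The functor that sends a sheaf `F` to the representation with stalk `Γ(star S, F)` at the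
vertex `S`, on which the arrows act by restriction. -/
def toRep : Sh R X ⥤ 𝒮.RepStrata R :=
  (satisfies (𝒮.relations R)).lift
    (TopCat.Sheaf.forget _ X ⋙ (Functor.whiskeringLeft _ _ _).obj 𝒮.starFunctor) (by
      rintro F _ ⟨S, T, p, q, rfl⟩
      have h : 𝒮.starFunctor.map p = 𝒮.starFunctor.map q := Subsingleton.elim _ _
      simp only [actRelation]
      rw [Finsupp.sum_sub_index (by intros; rw [sub_smul])]
      simp [h])

instance : (𝒮.toRep R).Additive where

end

section

variable {R : Type u} [CommRing R] [HasDerivedCategory.{w₁} (Sh R X)]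

/-- The property of an object of `D⁺(X)` that all its cohomology sheaves satisfy `P`. -/
def cohomologyPlus (P : ObjectProperty (Sh R X)) :
    ObjectProperty (DerivedCategory.Plus (Sh R X)) :=
  fun K ↦ ∀ n : ℤ, P ((DerivedCategory.homologyFunctor (Sh R X) n).obj K.obj)

/-- The property of an object of `Dᵇ(X)` that all its cohomology sheaves satisfy `P`. -/
def cohomologyBounded (P : ObjectProperty (Sh R X)) :
    ObjectProperty (DerivedCategory.Bounded (Sh R X)) :=
  fun K ↦ ∀ n : ℤ, P ((DerivedCategory.homologyFunctor (Sh R X) n).obj K.obj)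

end

section

variable (R : Type u) [CommRing R] [HasDerivedCategory.{w₁} (Sh R X)]

/-- `D⁺_{w,c}(X)`. -/
abbrev DPlusWC := (cohomologyPlus (𝒮.weaklyConstructible (R := R))).FullSubcategory

/-- `Dᵇ_{w,c}(X)`. -/
abbrev DBoundedWC := (cohomologyBounded (𝒮.weaklyConstructible (R := R))).FullSubcategory

/-- `Dᵇ_c(X)`. -/
abbrev DBoundedC := (cohomologyBounded (𝒮.constructible (R := R))).FullSubcategory

/-- The inclusion `Dᵇ(X) ⥤ D⁺(X)`. -/
abbrev boundedToPlus (X : TopCat.{u}) [HasDerivedCategory.{w₁} (Sh R X)] :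
    DerivedCategory.Bounded (Sh R X) ⥤ DerivedCategory.Plus (Sh R X) :=
  ObjectProperty.ιOfLE inf_le_left

end

end Stratification

end

/-!
For an acyclic stratification, the functor `Φ` of sections on the stars has a left adjoint `L`, a
left Kan extension along the stars followed by sheafification. If `x` lies in the stratum `S`, the
stalk of `L V` at `x` is `V S`, as one sees by mapping to skyscraper sheaves. Hence `L` is exact and
conservative with weakly constructible values, and acyclicity makes the counit `L Φ F ⟶ F`
invertible for every weakly constructible `F`.

Let `K` be a bounded below complex of injective sheaves whose cohomology sheaves are weakly
constructible. Sections on a star are morphisms from some sheaf `E`, and the vanishing of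
`Ext(E, -)` spreads from the terms and the cohomology of `K` to its cycles and boundaries, so that
`Φ` commutes with the cohomology of `K`. Therefore the counit of the derived adjunction
`D⁺(L) ⊣ RΦ` is invertible at `K`. As `D⁺(L)` is conservative, the unit is invertible too, and
`L Hⁿ(RΦ K) ≅ Hⁿ(K)` identifies the bounded and the constructible objects on both sides.

Representations with finitely generated stalks have enough projectives, and these stay projective
among all representations. So `Dᵇ(Rep_f) ⥤ D(Rep)` is fully faithful, and by dévissage its essential
image consists of the bounded objects with cohomology in `Rep_f`.
-/

noncomputable section

/-! ### Adjunctions between derived categories -/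

section HomotopyCategory

variable {A B : Type*} [Category* A] [Category* B] [Preadditive A] [Preadditive B]
  {L : B ⥤ A} {G : A ⥤ B} [L.Additive] [G.Additive] (adj : L ⊣ G)

/-- The adjunction between categories of complexes induced by an adjunction. -/
def mapHomologicalComplexAdjunction {ι : Type*} (c : ComplexShape ι) :
    L.mapHomologicalComplex c ⊣ G.mapHomologicalComplex c where
  unit :=
    { app K := { f n := adj.unit.app (K.X n), comm' _ _ _ := (adj.unit.naturality _).symm }
      naturality _ _ f := by ext n; exact adj.unit.naturality (f.f n) }
  counit :=
    { app K := { f n := adj.counit.app (K.X n), comm' _ _ _ := (adj.counit.naturality _).symm }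
      naturality _ _ f := by ext n; exact adj.counit.naturality (f.f n) }
  left_triangle_components K := by ext n; exact adj.left_triangle_components (K.X n)
  right_triangle_components K := by ext n; exact adj.right_triangle_components (K.X n)

/-- The adjunction between homotopy categories of complexes induced by an adjunction. -/
def mapHomotopyCategoryAdjunction {ι : Type*} (c : ComplexShape ι) :
    L.mapHomotopyCategory c ⊣ G.mapHomotopyCategory c where
  unit := Quotient.natTransLift _ (Functor.whiskerRight
    (mapHomologicalComplexAdjunction adj c).unit (HomotopyCategory.quotient B c))
  counit := Quotient.natTransLift _ (Functor.whiskerRight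
    (mapHomologicalComplexAdjunction adj c).counit (HomotopyCategory.quotient A c))
  left_triangle_components K := congr_arg (HomotopyCategory.quotient A c).map
    ((mapHomologicalComplexAdjunction adj c).left_triangle_components K.as)
  right_triangle_components K := congr_arg (HomotopyCategory.quotient B c).map
    ((mapHomologicalComplexAdjunction adj c).right_triangle_components K.as)

/-- The adjunction between bounded below homotopy categories of complexes induced by an
adjunction. -/
def mapHomotopyCategoryPlusAdjunction :
    L.mapHomotopyCategoryPlus ⊣ G.mapHomotopyCategoryPlus where
  unit :=
    { app K := ObjectProperty.homMk ((mapHomotopyCategoryAdjunction adj _).unit.app K.obj)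
      naturality _ _ f := by
        ext; exact (mapHomotopyCategoryAdjunction adj _).unit.naturality f.hom }
  counit :=
    { app K := ObjectProperty.homMk ((mapHomotopyCategoryAdjunction adj _).counit.app K.obj)
      naturality _ _ f := by
        ext; exact (mapHomotopyCategoryAdjunction adj _).counit.naturality f.hom }
  left_triangle_components K := by
    ext; exact (mapHomotopyCategoryAdjunction adj _).left_triangle_components K.obj
  right_triangle_components K := by
    ext; exact (mapHomotopyCategoryAdjunction adj _).right_triangle_components K.obj

end HomotopyCategory

section ExactFunctor

variable {C D : Type*} [Category* C] [Category* D] [Abelian C] [Abelian D]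
  (F : C ⥤ D) [F.Additive] [PreservesFiniteLimits F] [PreservesFiniteColimits F]

/-- An exact functor commutes with the homology of complexes. -/
def mapHomologicalComplexCompHomologyFunctorIso {ι : Type*} (c : ComplexShape ι) (i : ι) :
    F.mapHomologicalComplex c ⋙ HomologicalComplex.homologyFunctor D c i ≅
      HomologicalComplex.homologyFunctor C c i ⋙ F :=
  (Functor.isoWhiskerLeft (HomologicalComplex.shortComplexFunctor C c i)
    (ShortComplex.homologyFunctorIso F) :)

variable [HasDerivedCategory C] [HasDerivedCategory D]

/-- An exact functor commutes with the cohomology of objects of the derived category. -/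
def mapDerivedCategoryCompHomologyFunctorIso (n : ℤ) :
    F.mapDerivedCategory ⋙ DerivedCategory.homologyFunctor D n ≅
      DerivedCategory.homologyFunctor C n ⋙ F :=
  letI : Localization.Lifting DerivedCategory.Q (HomologicalComplex.quasiIso C (.up ℤ))
      (HomologicalComplex.homologyFunctor C _ n) (DerivedCategory.homologyFunctor C n) :=
    ⟨DerivedCategory.homologyFunctorFactors C n⟩
  letI : Localization.Lifting DerivedCategory.Q (HomologicalComplex.quasiIso C (.up ℤ))
      (F.mapHomologicalComplex _ ⋙ HomologicalComplex.homologyFunctor D _ n)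
      (F.mapDerivedCategory ⋙ DerivedCategory.homologyFunctor D n) :=
    ⟨Functor.isoWhiskerRight F.mapDerivedCategoryFactors _ ≪≫
      Functor.isoWhiskerLeft _ (DerivedCategory.homologyFunctorFactors D n)⟩
  Localization.liftNatIso DerivedCategory.Q (HomologicalComplex.quasiIso C (.up ℤ)) _ _ _ _
    (mapHomologicalComplexCompHomologyFunctorIso F _ n)

instance [F.ReflectsIsomorphisms] : F.mapDerivedCategory.ReflectsIsomorphisms where
  reflects f _ := by
    rw [DerivedCategory.isIso_iff]
    intro n
    have : IsIso (F.map ((DerivedCategory.homologyFunctor C n).map f)) :=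
      (NatIso.isIso_map_iff (mapDerivedCategoryCompHomologyFunctorIso F n) f).1
        (inferInstanceAs <| IsIso <|
          (DerivedCategory.homologyFunctor D n).map (F.mapDerivedCategory.map f))
    exact isIso_of_reflects_iso _ F

lemma isGE_mapDerivedCategory_obj (K : DerivedCategory C) (n : ℤ) [K.IsGE n] :
    (F.mapDerivedCategory.obj K).IsGE n := by
  rw [DerivedCategory.isGE_iff]
  exact fun i hi ↦ (F.map_isZero (K.isZero_of_isGE n i hi)).of_iso
    ((mapDerivedCategoryCompHomologyFunctorIso F i).app K)

/-- The functor between bounded below derived categories induced by an exact functor. -/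
def mapDerivedCategoryPlus : DerivedCategory.Plus C ⥤ DerivedCategory.Plus D :=
  DerivedCategory.TStructure.t.plus.lift (DerivedCategory.Plus.ι ⋙ F.mapDerivedCategory)
    fun ⟨K, n, _⟩ ↦ ⟨n, isGE_mapDerivedCategory_obj F K n⟩

instance [F.ReflectsIsomorphisms] : (mapDerivedCategoryPlus F).ReflectsIsomorphisms where
  reflects f _ := by
    have : IsIso (F.mapDerivedCategory.map (DerivedCategory.Plus.ι.map f)) :=
      inferInstanceAs (IsIso (DerivedCategory.Plus.ι.map ((mapDerivedCategoryPlus F).map f)))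
    have := isIso_of_reflects_iso (DerivedCategory.Plus.ι.map f) F.mapDerivedCategory
    exact isIso_of_reflects_iso f DerivedCategory.Plus.ι

/-- The functor `mapDerivedCategoryPlus F` is computed by applying `F` termwise to complexes. -/
def mapDerivedCategoryPlusFactors :
    DerivedCategory.Plus.Qh ⋙ mapDerivedCategoryPlus F ≅
      F.mapHomotopyCategoryPlus ⋙ DerivedCategory.Plus.Qh :=
  ((ObjectProperty.fullyFaithfulι _).whiskeringRight _).preimageIso
    (Functor.isoWhiskerLeft (HomotopyCategory.Plus.ι C) F.mapDerivedCategoryFactorsh :)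

instance : (mapDerivedCategoryPlus F).IsLeftDerivedFunctor
    (mapDerivedCategoryPlusFactors F).hom (HomotopyCategory.Plus.quasiIso C) :=
  Functor.isLeftDerivedFunctor_of_inverts _ _ _

end ExactFunctor

lemma isEquivalence_ι_comp_of_isIso_counit {C D : Type*} [Category* C] [Category* D]
    {F : C ⥤ D} {G : D ⥤ C} (adj : F ⊣ G) [F.ReflectsIsomorphisms] {P : ObjectProperty D}
    (hF : ∀ X, P (F.obj X)) (hP : ∀ Y, P Y → IsIso (adj.counit.app Y)) :
    (P.ι ⋙ G).IsEquivalence := by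
  let adj' : P.lift F hF ⊣ P.ι ⋙ G :=
    { unit := adj.unit
      counit := { app Y := ObjectProperty.homMk (adj.counit.app Y.obj)
                  naturality _ _ f := by ext; exact adj.counit.naturality f.hom }
      left_triangle_components X := by ext; exact adj.left_triangle_components X
      right_triangle_components Y := adj.right_triangle_components Y.obj }
  have hη (X : C) : IsIso (adj.unit.app X) := by
    have := hP _ (hF X)
    have := IsIso.of_isIso_fac_right (adj.left_triangle_components X)
    exact isIso_of_reflects_iso _ F
  have hε (Y : P.FullSubcategory) : IsIso (adj'.counit.app Y) := by
    have : IsIso (P.ι.map (adj'.counit.app Y)) := hP _ Y.property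
    exact isIso_of_reflects_iso _ P.ι
  exact adj'.toEquivalence.isEquivalence_inverse

section DerivedAdjunction

variable {A B : Type*} [Category* A] [Category* B] [Abelian A] [Abelian B]
  [HasDerivedCategory A] [HasDerivedCategory B] [EnoughInjectives A]
  {L : B ⥤ A} {G : A ⥤ B} [L.Additive] [G.Additive]
  [PreservesFiniteLimits L] [PreservesFiniteColimits L] (adj : L ⊣ G)

instance : (mapDerivedCategoryPlus L ⋙ G.rightDerivedFunctorPlus).IsLeftDerivedFunctor
    ((Functor.associator _ _ _).inv ≫
      Functor.whiskerRight (mapDerivedCategoryPlusFactors L).hom G.rightDerivedFunctorPlus)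
    (HomotopyCategory.Plus.quasiIso B) :=
  Functor.isLeftDerivedFunctor_of_inverts _ _
    ((Functor.associator _ _ _).symm ≪≫
      Functor.isoWhiskerRight (mapDerivedCategoryPlusFactors L) _)

instance : (G.rightDerivedFunctorPlus ⋙ mapDerivedCategoryPlus L).IsRightDerivedFunctor
    (Functor.whiskerRight G.rightDerivedFunctorPlusUnit (mapDerivedCategoryPlus L) ≫
      (Functor.associator _ _ _).hom)
    (HomotopyCategory.Plus.quasiIso A) :=
  (HomotopyCategory.Plus.localizerMorphism_derives _).isRightDerivedFunctor_of_isIso _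
    fun K ↦ by
      have : IsIso (G.rightDerivedFunctorPlusUnit.app
          ((InjectiveObject.ι A).mapHomotopyCategoryPlus.obj K)) := inferInstance
      exact inferInstanceAs (IsIso
        ((mapDerivedCategoryPlus L).map (G.rightDerivedFunctorPlusUnit.app
          ((InjectiveObject.ι A).mapHomotopyCategoryPlus.obj K)) ≫ 𝟙 _))

/-- The adjunction between the functor induced on bounded below derived categories by an exact left
adjoint and the right derived functor of its right adjoint. -/
def rightDerivedPlusAdjunction : mapDerivedCategoryPlus L ⊣ G.rightDerivedFunctorPlus :=
  (mapHomotopyCategoryPlusAdjunction adj).derived (HomotopyCategory.Plus.quasiIso B)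
    (HomotopyCategory.Plus.quasiIso A) (mapDerivedCategoryPlusFactors L).hom
    G.rightDerivedFunctorPlusUnit

lemma isIso_rightDerivedPlusAdjunction_counit_app_Q_obj (K : CochainComplex.Plus A)
    [∀ n, Injective (K.obj.X n)]
    (hK : QuasiIso ((mapHomologicalComplexAdjunction adj (.up ℤ)).counit.app K.obj)) :
    IsIso ((rightDerivedPlusAdjunction adj).counit.app (DerivedCategory.Plus.Q.obj K)) := by
  let K' := (HomotopyCategory.Plus.quotient A).obj K
  have : ∀ n, Injective (K'.obj.as.X n) := fun n ↦ inferInstanceAs (Injective (K.obj.X n))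
  have : IsIso (DerivedCategory.Plus.Qh.map
      ((mapHomotopyCategoryPlusAdjunction adj).counit.app K')) :=
    Localization.inverts _ (HomotopyCategory.Plus.quasiIso A) _
      ((HomotopyCategory.quotient_map_mem_quasiIso_iff _).2 hK)
  have hε : IsIso ((mapDerivedCategoryPlusFactors L).hom.app (G.mapHomotopyCategoryPlus.obj K') ≫
      DerivedCategory.Plus.Qh.map ((mapHomotopyCategoryPlusAdjunction adj).counit.app K')) :=
    inferInstance
  rw [← (mapHomotopyCategoryPlusAdjunction adj).derivedε_fac_app (HomotopyCategory.Plus.quasiIso A)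
    (mapDerivedCategoryPlusFactors L).hom G.rightDerivedFunctorPlusUnit K'] at hε
  exact (isIso_comp_left_iff
    ((mapDerivedCategoryPlus L).map (G.rightDerivedFunctorPlusUnit.app K')) _).1 hε

lemma isIso_rightDerivedPlusAdjunction_counit_app {W : ObjectProperty A}
    [W.IsClosedUnderIsomorphisms]
    (h : ∀ K : CochainComplex A ℤ, CochainComplex.plus A K → (∀ n, Injective (K.X n)) →
      (∀ n, W (K.homology n)) →
        QuasiIso ((mapHomologicalComplexAdjunction adj (.up ℤ)).counit.app K))
    (K : DerivedCategory.Plus A) (hK : ∀ n, W ((DerivedCategory.homologyFunctor A n).obj K.obj)) :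
    IsIso ((rightDerivedPlusAdjunction adj).counit.app K) := by
  obtain ⟨n, hn⟩ := K.property
  have : K.IsGE n := (K.isGE_ι_obj_iff n).1 hn
  obtain ⟨I, -, ⟨e⟩⟩ := K.exists_injective_nonempty_iso n
  let J := (InjectiveObject.ι A).mapCochainComplexPlus.obj I
  have hJ (n : ℤ) : Injective (J.obj.X n) := (I.obj.X n).property
  have hJW (n : ℤ) : W (J.obj.homology n) :=
    W.prop_of_iso ((DerivedCategory.homologyFunctor A n).mapIso
      (DerivedCategory.Plus.ι.mapIso e.symm) ≪≫
        (DerivedCategory.homologyFunctorFactors A n).app J.obj) (hK n)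
  rw [← NatTrans.isIso_app_iff_of_iso _ e]
  exact isIso_rightDerivedPlusAdjunction_counit_app_Q_obj adj J (h _ J.property hJ hJW)

end DerivedAdjunction

/-! ### Dévissage and fully faithful derived functors -/

section ReflectsZero

open ZeroObject

lemma isZero_of_isZero_map {C D : Type*} [Category* C] [Category* D] [HasZeroObject C]
    [HasZeroMorphisms C] [HasZeroMorphisms D] (F : C ⥤ D) [F.PreservesZeroMorphisms]
    [F.ReflectsIsomorphisms] {X : C} (h : IsZero (F.obj X)) : IsZero X := by
  have : IsIso (F.map (0 : X ⟶ 0)) :=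
    ⟨0, h.eq_of_src _ _, (F.map_isZero (isZero_zero C)).eq_of_src _ _⟩
  exact (isZero_zero C).of_iso (@asIso _ _ _ _ (0 : X ⟶ 0) (isIso_of_reflects_iso _ F))

end ReflectsZero

lemma bounded_iff_isZero_homology {C : Type*} [Category* C] [Abelian C] [HasDerivedCategory C]
    (K : DerivedCategory C) : DerivedCategory.TStructure.t.bounded K ↔
      (∃ a, ∀ i < a, IsZero ((DerivedCategory.homologyFunctor C i).obj K)) ∧
        ∃ b, ∀ i, b < i → IsZero ((DerivedCategory.homologyFunctor C i).obj K) :=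
  and_congr (exists_congr fun a ↦ K.isGE_iff a) (exists_congr fun b ↦ K.isLE_iff b)

section ExactConservativeFunctor

variable {C D : Type*} [Category* C] [Category* D] [Abelian C] [Abelian D]
  (F : C ⥤ D) [F.Additive] [PreservesFiniteLimits F] [PreservesFiniteColimits F]
  [HasDerivedCategory C] [HasDerivedCategory D] [F.ReflectsIsomorphisms]

lemma isZero_homology_mapDerivedCategory_obj_iff (K : DerivedCategory C) (n : ℤ) :
    IsZero ((DerivedCategory.homologyFunctor D n).obj (F.mapDerivedCategory.obj K)) ↔
      IsZero ((DerivedCategory.homologyFunctor C n).obj K) :=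
  ((mapDerivedCategoryCompHomologyFunctorIso F n).app K).isZero_iff.trans
    ⟨isZero_of_isZero_map F, F.map_isZero⟩

lemma bounded_mapDerivedCategory_obj_iff (K : DerivedCategory C) :
    DerivedCategory.TStructure.t.bounded (F.mapDerivedCategory.obj K) ↔
      DerivedCategory.TStructure.t.bounded K := by
  simp only [bounded_iff_isZero_homology, isZero_homology_mapDerivedCategory_obj_iff]

end ExactConservativeFunctor

section Devissage

variable {C : Type*} [Category* C] [Abelian C] [HasDerivedCategory C]

open DerivedCategory Pretriangulated

lemma isIso_homologyMap_mor₁ {T : Triangle (DerivedCategory C)} (hT : T ∈ distTriang _) (n : ℤ)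
    (h₀ : IsZero ((homologyFunctor C (n - 1)).obj T.obj₃))
    (h₁ : IsZero ((homologyFunctor C n).obj T.obj₃)) :
    IsIso ((homologyFunctor C n).map T.mor₁) := by
  have : Epi ((homologyFunctor C n).map T.mor₁) :=
    (HomologySequence.epi_homologyMap_mor₁_iff T hT n).2 (h₁.eq_of_tgt _ _)
  have : Mono ((homologyFunctor C n).map T.mor₁) :=
    (HomologySequence.mono_homologyMap_mor₁_iff T hT (n - 1) n).2 (h₀.eq_of_src _ _)
  exact isIso_of_mono_of_epi _

lemma isIso_homologyMap_mor₂ {T : Triangle (DerivedCategory C)} (hT : T ∈ distTriang _) (n : ℤ)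
    (h₀ : IsZero ((homologyFunctor C n).obj T.obj₁))
    (h₁ : IsZero ((homologyFunctor C (n + 1)).obj T.obj₁)) :
    IsIso ((homologyFunctor C n).map T.mor₂) := by
  have : Epi ((homologyFunctor C n).map T.mor₂) :=
    (HomologySequence.epi_homologyMap_mor₂_iff T hT n (n + 1)).2 (h₁.eq_of_tgt _ _)
  have : Mono ((homologyFunctor C n).map T.mor₂) :=
    (HomologySequence.mono_homologyMap_mor₂_iff T hT n).2 (h₀.eq_of_src _ _)
  exact isIso_of_mono_of_epi _

lemma exists_truncation_triangle (K : DerivedCategory C) (n : ℤ) :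
    ∃ T ∈ distTriang (DerivedCategory C), T.obj₂ = K ∧ T.obj₁.IsLE n ∧ T.obj₃.IsGE (n + 1) ∧
      (∀ i ≤ n, Nonempty ((homologyFunctor C i).obj T.obj₁ ≅ (homologyFunctor C i).obj K)) ∧
      ∀ i > n, Nonempty ((homologyFunctor C i).obj T.obj₃ ≅ (homologyFunctor C i).obj K) := by
  obtain ⟨K₁, K₃, h₁, h₃, f, g, δ, hT⟩ := TStructure.t.exists_triangle K n (n + 1) rfl
  have : K₁.IsLE n := ⟨h₁⟩
  have : K₃.IsGE (n + 1) := ⟨h₃⟩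
  refine ⟨_, hT, rfl, ‹_›, ‹_›, fun i hi ↦ ?_, fun i hi ↦ ?_⟩
  · have : IsIso ((homologyFunctor C i).map f) := isIso_homologyMap_mor₁ hT i
      (K₃.isZero_of_isGE (n + 1) _ (by lia)) (K₃.isZero_of_isGE (n + 1) _ (by lia))
    exact ⟨@asIso _ _ _ _ ((homologyFunctor C i).map f) this⟩
  · have : IsIso ((homologyFunctor C i).map g) := isIso_homologyMap_mor₂ hT i
      (K₁.isZero_of_isLE n _ (by lia)) (K₁.isZero_of_isLE n _ (by lia))
    exact ⟨(asIso ((homologyFunctor C i).map g)).symm⟩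

variable {P : ObjectProperty (DerivedCategory C)} [P.IsClosedUnderIsomorphisms]
  {W : ObjectProperty C} [W.IsClosedUnderIsomorphisms]

lemma prop_of_isGE_of_isLE (single : ∀ (A : C) (n : ℤ), W A → P ((singleFunctor C n).obj A))
    (K : DerivedCategory C) (n : ℤ) [K.IsGE n] [K.IsLE n] (h : W ((homologyFunctor C n).obj K)) :
    P K := by
  obtain ⟨A, ⟨e⟩⟩ := K.exists_iso_singleFunctor_obj_of_isGE_of_isLE n
  exact P.prop_of_iso e.symm (single A n (W.prop_of_iso ((homologyFunctor C n).mapIso e ≪≫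
    (singleFunctorCompHomologyFunctorIso C n).app A) h))

lemma prop_of_bounded [P.IsTriangulatedClosed₂]
    (single : ∀ (A : C) (n : ℤ), W A → P ((singleFunctor C n).obj A))
    (K : DerivedCategory C) (hK : TStructure.t.bounded K)
    (h : ∀ n, W ((homologyFunctor C n).obj K)) : P K := by
  obtain ⟨⟨a, ha⟩, ⟨b, hb⟩⟩ := hK
  have hb' : K.IsLE (a + (b - a).toNat) := TStructure.t.isLE_of_le K b _
  generalize (b - a).toNat = k at hb'
  clear hb
  induction k generalizing K with
  | zero =>
    have : K.IsLE a := by simpa using hb'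
    exact prop_of_isGE_of_isLE single K a (h a)
  | succ k ih =>
    obtain ⟨T, hT, rfl, hT₁, hT₃, e₁, e₃⟩ := exists_truncation_triangle K (a + k)
    have hW {A : C} (hA : IsZero A) : W A :=
      W.prop_of_iso ((T.obj₂.isZero_of_isGE a (a - 1) (by lia)).iso hA) (h _)
    refine P.ext_of_isTriangulatedClosed₂ T hT (ih T.obj₁ (fun i ↦ ?_) ?_ hT₁) ?_
    · by_cases hi : i ≤ a + k
      · exact W.prop_of_iso (e₁ i hi).some.symm (h i)
      · exact hW (T.obj₁.isZero_of_isLE (a + k) i (by lia))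
    · exact (isGE_iff _ _).2 fun i hi ↦
        (T.obj₂.isZero_of_isGE a i hi).of_iso (e₁ i (by lia)).some
    · have : T.obj₃.IsLE (a + k + 1) := (isLE_iff _ _).2 fun i hi ↦
        (T.obj₂.isZero_of_isLE (a + (k + 1 : ℕ)) i (by lia)).of_iso (e₃ i (by lia)).some
      exact prop_of_isGE_of_isLE single T.obj₃ (a + k + 1)
        (W.prop_of_iso (e₃ _ (by lia)).some.symm (h _))

end Devissage

section FullyFaithfulFrom

open Pretriangulated

variable {C D : Type*} [Category* C] [Category* D] (F : C ⥤ D)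

lemma bijective_map_of_iso {X Y X' Y' : C} (e : X ≅ X') (e' : Y ≅ Y')
    (h : Function.Bijective (F.map : (X ⟶ Y) → _)) :
    Function.Bijective (F.map : (X' ⟶ Y') → _) := by
  have hF : (F.map : (X' ⟶ Y') → _) =
      ((F.mapIso e).homCongr (F.mapIso e')) ∘ F.map ∘ (e.homCongr e').symm := by
    ext f
    simp [Iso.homCongr]
  rw [hF]
  exact (Equiv.bijective _).comp (h.comp (Equiv.bijective _))

variable {F} in
lemma bijective_map_of_natIso {G : C ⥤ D} (e : F ≅ G) {X Y : C}
    (h : Function.Bijective (F.map : (X ⟶ Y) → _)) :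
    Function.Bijective (G.map : (X ⟶ Y) → _) := by
  have hG : (G.map : (X ⟶ Y) → _) = (e.app X).homCongr (e.app Y) ∘ F.map := by
    ext f
    simp [Iso.homCongr]
  rw [hG]
  exact (Equiv.bijective _).comp h

/-- The objects `X` such that `F` is bijective on all the types of morphisms `X ⟶ Y`: this makes
sense of the full faithfulness of `F` one object at a time. -/
def fullyFaithfulFrom : ObjectProperty C :=
  fun X ↦ ∀ Y, Function.Bijective (F.map : (X ⟶ Y) → _)

instance : (fullyFaithfulFrom F).IsClosedUnderIsomorphisms where
  of_iso e h Y := bijective_map_of_iso F e (Iso.refl Y) (h Y)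

lemma full_ι_comp_of_le_fullyFaithfulFrom {P : ObjectProperty C} (h : P ≤ fullyFaithfulFrom F) :
    (P.ι ⋙ F).Full where
  map_surjective {X Y} f := by
    obtain ⟨g, rfl⟩ := (h _ X.property Y.obj).surjective f
    exact ⟨ObjectProperty.homMk g, rfl⟩

lemma faithful_ι_comp_of_le_fullyFaithfulFrom {P : ObjectProperty C}
    (h : P ≤ fullyFaithfulFrom F) : (P.ι ⋙ F).Faithful where
  map_injective {X Y _ _} hfg := P.ι.map_injective ((h _ X.property Y.obj).injective hfg)

variable [HasShift C ℤ] [HasShift D ℤ] [F.CommShift ℤ]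

instance : (fullyFaithfulFrom F).IsStableUnderShift ℤ where
  isStableUnderShiftBy a :=
    { le_shift := fun X h Y ↦ by
        refine bijective_map_of_iso F (Iso.refl _) ((shiftEquiv C a).counitIso.app Y) ?_
        have hF : Function.Bijective
            ((shiftFunctor C a ⋙ F).map : (X ⟶ (shiftFunctor C (-a)).obj Y) → _) :=
          bijective_map_of_natIso (F.commShiftIso a).symm
            (((Functor.FullyFaithful.ofFullyFaithful (shiftFunctor D a)).map_bijective _ _).comp
              (h _))
        exact (Function.Bijective.of_comp_iff _
          ((Functor.FullyFaithful.ofFullyFaithful (shiftFunctor C a)).map_bijective _ _)).1 hF }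

variable [HasZeroObject C] [HasZeroObject D] [Preadditive C] [Preadditive D]
  [∀ n : ℤ, (shiftFunctor C n).Additive] [∀ n : ℤ, (shiftFunctor D n).Additive]
  [Pretriangulated C] [Pretriangulated D] [F.IsTriangulated]
  {T : Triangle C} (hT : T ∈ distTriang C)

variable {F} in
include hT in
lemma injective_map_from_obj₂ (h₁ : fullyFaithfulFrom F T.obj₁)
    (h₃ : fullyFaithfulFrom F T.obj₃) (Y : C) :
    Function.Injective (F.map : (T.obj₂ ⟶ Y) → _) := by
  have hT' := F.map_distinguished T hT
  rw [show (F.map : (T.obj₂ ⟶ Y) → _) = F.mapAddHom from rfl, injective_iff_map_eq_zero]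
  intro f (hf : F.map f = 0)
  obtain ⟨g, rfl⟩ := Triangle.yoneda_exact₂ T hT f ((h₁ Y).injective (by
    rw [F.map_comp, hf, comp_zero, F.map_zero]))
  obtain ⟨k, hk⟩ : ∃ k : F.obj T.obj₁⟦(1 : ℤ)⟧ ⟶ F.obj Y,
      F.map g = (F.map T.mor₃ ≫ (F.commShiftIso (1 : ℤ)).hom.app T.obj₁) ≫ k :=
    Triangle.yoneda_exact₃ _ hT' (F.map g) ((F.map_comp _ _).symm.trans hf)
  obtain ⟨l, hl⟩ := ((fullyFaithfulFrom F).le_shift (1 : ℤ) _ h₁ Y).surjective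
    ((F.commShiftIso (1 : ℤ)).hom.app T.obj₁ ≫ k)
  obtain rfl : g = T.mor₃ ≫ l := (h₃ Y).injective (by
    rw [F.map_comp, hl, hk, Category.assoc])
  rw [comp_distTriang_mor_zero₂₃_assoc _ hT, zero_comp]

variable {F} in
include hT in
lemma surjective_map_from_obj₂ (h₁ : fullyFaithfulFrom F T.obj₁)
    (h₃ : fullyFaithfulFrom F T.obj₃) (Y : C) :
    Function.Surjective (F.map : (T.obj₂ ⟶ Y) → _) := by
  intro f
  obtain ⟨g, hg⟩ := (h₁ Y).surjective (F.map T.mor₁ ≫ f)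
  obtain ⟨f₁, hf₁⟩ : ∃ f₁ : T.obj₂ ⟶ Y, g = T.mor₁ ≫ f₁ := by
    let r : T.obj₃⟦(-1 : ℤ)⟧ ⟶ T.obj₁ := T.invRotate.mor₁
    have hr : r ≫ T.mor₁ = 0 := comp_distTriang_mor_zero₁₂ _ (inv_rot_of_distTriang _ hT)
    have hrg : r ≫ g = 0 := ((fullyFaithfulFrom F).le_shift (-1 : ℤ) _ h₃ Y).injective (by
      rw [F.map_comp, hg, ← F.map_comp_assoc, hr, F.map_zero, zero_comp, F.map_zero])
    exact Triangle.yoneda_exact₂ _ (inv_rot_of_distTriang _ hT) g hrg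
  obtain ⟨k, hk⟩ : ∃ k : F.obj T.obj₃ ⟶ F.obj Y, f - F.map f₁ = F.map T.mor₂ ≫ k :=
    Triangle.yoneda_exact₂ _ (F.map_distinguished T hT) (f - F.map f₁) (by
      change F.map T.mor₁ ≫ _ = 0
      rw [Preadditive.comp_sub, ← F.map_comp, ← hf₁, hg, sub_self])
  obtain ⟨l, rfl⟩ := (h₃ Y).surjective k
  exact ⟨f₁ + T.mor₂ ≫ l, by rw [F.map_add, F.map_comp, ← hk, add_sub_cancel]⟩

instance : (fullyFaithfulFrom F).IsTriangulatedClosed₂ :=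
  .mk' fun _ hT h₁ h₃ Y ↦
    ⟨injective_map_from_obj₂ hT h₁ h₃ Y, surjective_map_from_obj₂ hT h₁ h₃ Y⟩

end FullyFaithfulFrom

lemma preservesProjectiveObjects_of_exists_epi {C D : Type*} [Category* C] [Category* D]
    (F : C ⥤ D) (h : ∀ X : C, ∃ (P : C) (p : P ⟶ X), Epi p ∧ Projective (F.obj P)) :
    F.PreservesProjectiveObjects where
  projective_obj {X} _ := by
    obtain ⟨P, p, _, _⟩ := h X
    let r : Retract X P := ⟨Projective.factorThru (𝟙 X) p, p, Projective.factorThru_comp _ _⟩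
    exact (r.map F).projective

section BoundedEssentialImage

open DerivedCategory

variable {C D : Type*} [Category* C] [Category* D] [Abelian C] [Abelian D]
  (F : C ⥤ D) [F.Additive] [PreservesFiniteLimits F] [PreservesFiniteColimits F]
  [F.Full] [F.Faithful] [HasDerivedCategory C] [HasDerivedCategory D]

lemma bijective_mapDerivedCategory_map_of_isKProjective
    (P K : CochainComplex C ℤ) [P.IsKProjective]
    [CochainComplex.IsKProjective ((F.mapHomologicalComplex _).obj P)] :
    Function.Bijective (F.mapDerivedCategory.map : (Q.obj P ⟶ Q.obj K) → _) := by
  refine bijective_map_of_iso F.mapDerivedCategory ((quotientCompQhIso C).app P)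
    ((quotientCompQhIso C).app K) ?_
  have hF : Function.Bijective ((F.mapHomotopyCategory (.up ℤ) ⋙ Qh).map :
      ((HomotopyCategory.quotient _ _).obj P ⟶ (HomotopyCategory.quotient _ _).obj K) → _) :=
    (CochainComplex.IsKProjective.Qh_map_bijective ((F.mapHomologicalComplex _).obj P) _).comp
      ((Functor.FullyFaithful.ofFullyFaithful (F.mapHomotopyCategory (.up ℤ))).map_bijective _ _)
  exact (Function.Bijective.of_comp_iff _
    (CochainComplex.IsKProjective.Qh_map_bijective P _)).1
      (bijective_map_of_natIso F.mapDerivedCategoryFactorsh.symm hF)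

variable [EnoughProjectives C] [F.PreservesProjectiveObjects]

lemma fullyFaithfulFrom_mapDerivedCategory_singleFunctor_obj (A : C) (n : ℤ) :
    fullyFaithfulFrom F.mapDerivedCategory ((singleFunctor C n).obj A) := by
  suffices h : fullyFaithfulFrom F.mapDerivedCategory ((singleFunctor C 0).obj A) from
    ObjectProperty.prop_of_iso _ (((singleFunctors C).shiftIso (-n) n 0 (by lia)).app A)
      ((fullyFaithfulFrom F.mapDerivedCategory).le_shift (-n) _ h)
  intro K
  obtain ⟨P⟩ : Nonempty (ProjectiveResolution A) := HasProjectiveResolution.out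
  let FP : CochainComplex D ℤ := (F.mapHomologicalComplex (.up ℤ)).obj P.cochainComplex
  have (i : ℤ) : Projective (FP.X i) :=
    F.projective_obj_of_projective (X := P.cochainComplex.X i) inferInstance
  have : FP.IsStrictlyLE 0 :=
    inferInstanceAs (CochainComplex.IsStrictlyLE
      ((F.mapHomologicalComplex (.up ℤ)).obj P.cochainComplex) 0)
  have := FP.isKProjective_of_projective 0
  have := P.cochainComplex.isKProjective_of_projective 0
  exact bijective_map_of_iso F.mapDerivedCategory
    (asIso (Q.map P.π') ≪≫ ((singleFunctorIsoCompQ C 0).app A).symm) (Q.objObjPreimageIso K)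
    (bijective_mapDerivedCategory_map_of_isKProjective F P.cochainComplex _)

lemma bounded_le_fullyFaithfulFrom_mapDerivedCategory :
    TStructure.t.bounded ≤ fullyFaithfulFrom F.mapDerivedCategory :=
  fun K hK ↦ prop_of_bounded (W := ⊤)
    (fun A n _ ↦ fullyFaithfulFrom_mapDerivedCategory_singleFunctor_obj F A n) K hK fun _ ↦ trivial

instance : (Bounded.ι ⋙ F.mapDerivedCategory).Full :=
  full_ι_comp_of_le_fullyFaithfulFrom _ (bounded_le_fullyFaithfulFrom_mapDerivedCategory F)

instance : (Bounded.ι ⋙ F.mapDerivedCategory).Faithful :=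
  faithful_ι_comp_of_le_fullyFaithfulFrom _ (bounded_le_fullyFaithfulFrom_mapDerivedCategory F)

lemma essImage_bounded_mapDerivedCategory_iff (K : DerivedCategory D) :
    (Bounded.ι ⋙ F.mapDerivedCategory).essImage K ↔
      TStructure.t.bounded K ∧ ∀ n, F.essImage ((homologyFunctor D n).obj K) := by
  constructor
  · rintro ⟨V, ⟨e⟩⟩
    exact ⟨ObjectProperty.prop_of_iso _ e
      ((bounded_mapDerivedCategory_obj_iff F V.obj).2 V.property), fun n ↦
        ⟨_, ⟨((mapDerivedCategoryCompHomologyFunctorIso F n).app V.obj).symm ≪≫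
          (homologyFunctor D n).mapIso e⟩⟩⟩
  · rintro ⟨hK, h⟩
    refine prop_of_bounded (fun A n ⟨V, ⟨e⟩⟩ ↦ ?_) K hK h
    exact ⟨⟨(singleFunctor C n).obj V, ⟨n, inferInstance⟩, ⟨n, inferInstance⟩⟩,
      ⟨(F.mapDerivedCategorySingleFunctor n).app V ≪≫ (singleFunctor D n).mapIso e⟩⟩

end BoundedEssentialImage

lemma exists_equivalence_comp_iso_of_essImage_eq {C D E : Type*} [Category* C] [Category* D]
    [Category* E] (F : C ⥤ E) (G : D ⥤ E) [F.Full] [F.Faithful] [G.Full] [G.Faithful]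
    (h : F.essImage = G.essImage) : ∃ e : C ≌ D, Nonempty (e.functor ⋙ G ≅ F) := by
  have hF (X : C) : G.essImage (F.obj X) := h ▸ F.obj_mem_essImage X
  let H : C ⥤ D := Functor.essImage.liftFunctor F G hF
  let i : H ⋙ G ≅ F := Functor.essImage.liftFunctorCompIso F G hF
  have : (H ⋙ G).Full := .of_iso i.symm
  have : (H ⋙ G).Faithful := .of_iso i.symm
  have : H.Full := .of_comp_faithful H G
  have : H.Faithful := .of_comp H G
  have : H.EssSurj :=
    { mem_essImage := fun Y ↦ by
        obtain ⟨X, ⟨e⟩⟩ : F.essImage (G.obj Y) := h ▸ G.obj_mem_essImage Y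
        exact ⟨X, ⟨G.preimageIso (i.app X ≪≫ e)⟩⟩ }
  have : H.IsEquivalence := { }
  exact ⟨H.asEquivalence, ⟨i⟩⟩

/-! ### Complexes with acyclic terms and acyclic homology -/

section CorepresentableBy

variable {A : Type*} [Category* A] {R : Type u} [Ring R] {G : A ⥤ ModuleCat.{u} R} {E : A}
  (h : (G ⋙ forget _).CorepresentableBy E)

include h

lemma epi_map_iff_of_corepresentableBy {F F' : A} (g : F ⟶ F') :
    Epi (G.map g) ↔ ∀ f : E ⟶ F', ∃ k : E ⟶ F, k ≫ g = f := by
  rw [ModuleCat.epi_iff_surjective]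
  refine ⟨fun hg f ↦ ?_, fun hg z ↦ ?_⟩
  · obtain ⟨v, hv⟩ := hg (h.homEquiv f)
    exact ⟨h.homEquiv.symm v, h.homEquiv.injective
      ((h.homEquiv_comp g _).trans ((congr_arg _ (h.homEquiv.apply_symm_apply v)).trans hv))⟩
  · obtain ⟨k, hk⟩ := hg (h.homEquiv.symm z)
    exact ⟨h.homEquiv k, (h.homEquiv_comp g k).symm.trans (hk ▸ h.homEquiv.apply_symm_apply z)⟩

lemma projective_of_corepresentableBy [G.PreservesEpimorphisms] : Projective E where
  factors f g _ := (epi_map_iff_of_corepresentableBy h g).1 inferInstance f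

variable [Preadditive A] [G.PreservesZeroMorphisms]

lemma homEquiv_eq_zero_iff_of_corepresentableBy {F : A} (f : E ⟶ F) :
    h.homEquiv f = (0 : G.obj F) ↔ f = 0 := by
  have h₀ : h.homEquiv (0 : E ⟶ F) = (0 : G.obj F) := by
    rw [h.homEquiv_eq]
    exact ConcreteCategory.congr_hom (G.map_zero E F) _
  rw [← h₀, h.homEquiv.apply_eq_iff_eq]

lemma exact_map_iff_of_corepresentableBy (S : ShortComplex A) :
    (S.map G).Exact ↔ ∀ f : E ⟶ S.X₂, f ≫ S.g = 0 → ∃ k : E ⟶ S.X₁, k ≫ S.f = f := by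
  have hg (f : E ⟶ S.X₂) : (S.map G).g (h.homEquiv f) = 0 ↔ f ≫ S.g = 0 := by
    rw [← homEquiv_eq_zero_iff_of_corepresentableBy h, h.homEquiv_comp]
    rfl
  have hf (k : E ⟶ S.X₁) (f : E ⟶ S.X₂) :
      (S.map G).f (h.homEquiv k) = h.homEquiv f ↔ k ≫ S.f = f := by
    rw [← h.homEquiv.apply_eq_iff_eq, h.homEquiv_comp]
    rfl
  rw [ShortComplex.moduleCat_exact_iff]
  refine ⟨fun hS f hfg ↦ ?_, fun hS z hz ↦ ?_⟩
  · obtain ⟨y, hy⟩ := hS (h.homEquiv f) ((hg f).2 hfg)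
    obtain ⟨k, rfl⟩ := h.homEquiv.surjective y
    exact ⟨k, (hf k f).1 hy⟩
  · obtain ⟨f, rfl⟩ := h.homEquiv.surjective z
    obtain ⟨k, hk⟩ := hS f ((hg f).1 hz)
    exact ⟨h.homEquiv k, (hf k f).2 hk⟩

end CorepresentableBy

section ExtAcyclic

universe w v u'

open CategoryTheory.Abelian

variable {A : Type u'} [Category.{v} A] [Abelian A] [HasExt.{w} A]

/-- `F` is acyclic for the functor `Hom(E, -)`: all the higher extensions of `E` by `F` vanish. -/
def ExtAcyclic (E F : A) : Prop := ∀ n : ℕ, Subsingleton (Ext E F (n + 1))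

lemma ExtAcyclic.of_injective (E F : A) [Injective F] : ExtAcyclic E F :=
  fun n ↦ Ext.subsingleton_of_injective E F n

lemma ExtAcyclic.of_isZero (E : A) {F : A} (hF : IsZero F) : ExtAcyclic E F :=
  have := hF.injective
  .of_injective E F

variable {E : A} {S : ShortComplex A}

lemma ExtAcyclic.X₂ (hS : S.ShortExact) (h₁ : ExtAcyclic E S.X₁) (h₃ : ExtAcyclic E S.X₃) :
    ExtAcyclic E S.X₂ := fun n ↦ ⟨fun x y ↦ by
  have := h₁ n
  have := h₃ n
  obtain ⟨z, hz⟩ := Ext.covariant_sequence_exact₂ _ hS (x - y) (Subsingleton.elim _ _)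
  rw [Subsingleton.elim z 0, Ext.zero_comp] at hz
  exact sub_eq_zero.1 hz.symm⟩

lemma ExtAcyclic.X₃ (hS : S.ShortExact) (h₁ : ExtAcyclic E S.X₁) (h₂ : ExtAcyclic E S.X₂) :
    ExtAcyclic E S.X₃ := fun n ↦ ⟨fun x y ↦ by
  have := h₁ (n + 1)
  have := h₂ n
  obtain ⟨z, hz⟩ := Ext.covariant_sequence_exact₃ _ hS (x - y) rfl (Subsingleton.elim _ _)
  rw [Subsingleton.elim z 0, Ext.zero_comp] at hz
  exact sub_eq_zero.1 hz.symm⟩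

lemma ExtAcyclic.exists_lift (hS : S.ShortExact) (h₁ : ExtAcyclic E S.X₁) (f : E ⟶ S.X₃) :
    ∃ g : E ⟶ S.X₂, g ≫ S.g = f := by
  have := h₁ 0
  obtain ⟨z, hz⟩ := Ext.covariant_sequence_exact₃ _ hS (Ext.mk₀ f) rfl (Subsingleton.elim _ _)
  obtain ⟨g, rfl⟩ := Ext.homEquiv₀.symm.surjective z
  exact ⟨g, Ext.homEquiv₀.symm.injective (by simpa using hz)⟩

lemma ExtAcyclic.of_isZero_rightDerived {R : Type u} [Ring R] {G : A ⥤ ModuleCat.{u} R}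
    [G.Additive] (h : (G ⋙ forget _).CorepresentableBy E) [EnoughInjectives A] {F : A}
    (hF : ∀ i > 0, IsZero ((G.rightDerived i).obj F)) : ExtAcyclic E F := by
  intro n
  obtain ⟨I⟩ : Nonempty (InjectiveResolution F) := HasInjectiveResolution.out
  have hI : ((I.cocomplex.sc' n (n + 1) (n + 2)).map G).Exact := by
    change (((G.mapHomologicalComplex _).obj I.cocomplex).sc' n (n + 1) (n + 2)).Exact
    rw [← HomologicalComplex.exactAt_iff' _ n (n + 1) (n + 2) (by simp) (by simp),
      HomologicalComplex.exactAt_iff_isZero_homology]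
    exact (hF (n + 1) (by simp)).of_iso (I.isoRightDerivedObj G (n + 1)).symm
  refine subsingleton_of_forall_eq 0 fun x ↦ ?_
  obtain ⟨f, hf, rfl⟩ := I.extMk_surjective x (n + 2) rfl
  rw [I.extMk_eq_zero_iff _ _ _ _ n rfl]
  exact (exact_map_iff_of_corepresentableBy h _).1 hI f hf

end ExtAcyclic

section CyclesBoundaries

variable {A ι : Type*} [Category* A] [Abelian A] {c : ComplexShape ι}
  (K : HomologicalComplex A c) (i n : ι)

/-- The short complex `Bⁿ ⟶ Zⁿ ⟶ Hⁿ` of boundaries, cycles and homology, where `Bⁿ` is encoded as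
the kernel of the projection `Zⁿ ⟶ Hⁿ`. -/
def boundariesCycles : ShortComplex A :=
  ShortComplex.mk (kernel.ι (K.homologyπ n)) (K.homologyπ n) (kernel.condition _)

lemma boundariesCycles_shortExact : (boundariesCycles K n).ShortExact where
  exact := ShortComplex.exact_kernel _
  mono_f := inferInstanceAs (Mono (kernel.ι (K.homologyπ n)))
  epi_g := inferInstanceAs (Epi (K.homologyπ n))

/-- The short complex `Zⁱ ⟶ Kⁱ ⟶ Bⁿ` of cycles, chains and boundaries; it is of interest when `n`
is the successor of `i`. -/
def cyclesBoundaries : ShortComplex A :=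
  ShortComplex.mk (K.iCycles i) (kernel.lift (K.homologyπ n) (K.toCycles i n) (by simp))
    (by simp [← cancel_mono (kernel.ι _), ← cancel_mono (K.iCycles n)])

variable {i n}

lemma cyclesBoundaries_shortExact (hi : c.prev n = i) (hn : c.next i = n) :
    (cyclesBoundaries K i n).ShortExact := by
  have hπ : (ShortComplex.mk (K.toCycles i n) (K.homologyπ n) (by simp)).Exact :=
    ShortComplex.exact_of_g_is_cokernel _ (K.homologyIsCokernel i n hi)
  have hZ : (ShortComplex.mk (K.iCycles i) (K.d i n) (by simp)).Exact :=
    ShortComplex.exact_of_f_is_kernel _ (K.cyclesIsKernel i n hn)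
  refine { exact := ?_
           mono_f := inferInstanceAs (Mono (K.iCycles _))
           epi_g := hπ.epi_kernelLift }
  let φ : cyclesBoundaries K i n ⟶ ShortComplex.mk (K.iCycles i) (K.d i n) (by simp) :=
    { τ₁ := 𝟙 _
      τ₂ := 𝟙 _
      τ₃ := kernel.ι _ ≫ K.iCycles n
      comm₁₂ := by simp [cyclesBoundaries]
      comm₂₃ := by simp [cyclesBoundaries] }
  have : Epi φ.τ₁ := inferInstanceAs (Epi (𝟙 _))
  have : IsIso φ.τ₂ := inferInstanceAs (IsIso (𝟙 _))
  have : Mono φ.τ₃ := inferInstanceAs (Mono (kernel.ι _ ≫ K.iCycles n))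
  exact (ShortComplex.exact_iff_of_epi_of_isIso_of_mono φ).2 hZ

lemma preservesLeftHomologyOf_sc_of_exact_of_epi {B : Type*} [Category* B] [Abelian B] (G : A ⥤ B)
    [G.PreservesZeroMorphisms] [PreservesFiniteLimits G]
    (hG : ((ShortComplex.mk (K.toCycles (c.prev n) n) (K.homologyπ n) (by simp)).map G).Exact)
    (hG' : Epi (G.map (K.homologyπ n))) : G.PreservesLeftHomologyOf (K.sc n) := by
  let h : (K.sc n).LeftHomologyData :=
    { K := K.cycles n
      H := K.homology n
      i := K.iCycles n
      π := K.homologyπ n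
      wi := (K.sc n).iCycles_g
      hi := (K.sc n).cyclesIsKernel
      wπ := (K.sc n).toCycles_comp_homologyπ
      hπ := (K.sc n).homologyIsCokernel }
  have : Epi ((ShortComplex.mk (K.toCycles (c.prev n) n) (K.homologyπ n) (by simp)).map G).g := hG'
  have : h.IsPreservedBy G :=
    { g := inferInstance
      f' := preservesColimit_of_preserves_colimit_cocone h.hπ
        ((CokernelCofork.isColimitMapCoconeEquiv _ G).symm hG.gIsCokernel) }
  exact Functor.PreservesLeftHomologyOf.mk' G h

end CyclesBoundaries

section AcyclicComplexes

universe w v u'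

variable {A : Type u'} [Category.{v} A] [Abelian A] [CategoryTheory.HasExt.{w} A] {E : A}
  {K : CochainComplex A ℤ} (hK : CochainComplex.plus A K) (hX : ∀ n, ExtAcyclic E (K.X n))
  (hH : ∀ n, ExtAcyclic E (K.homology n)) (n : ℤ)

include hX hH in
lemma extAcyclic_boundaries_and_cycles_of_pred (h : ExtAcyclic E (K.cycles (n - 1))) :
    ExtAcyclic E (boundariesCycles K n).X₁ ∧ ExtAcyclic E (K.cycles n) :=
  have hB : ExtAcyclic E (boundariesCycles K n).X₁ :=
    .X₃ (cyclesBoundaries_shortExact K (by simp) (by simp)) h (hX _)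
  ⟨hB, .X₂ (boundariesCycles_shortExact K n) hB (hH n)⟩

include hK hX hH

lemma extAcyclic_cycles : ExtAcyclic E (K.cycles n) := by
  obtain ⟨a, ha⟩ := hK
  have of_lt (n : ℤ) (hn : n < a) : ExtAcyclic E (K.cycles n) :=
    .of_isZero _ ((K.isZero_of_isStrictlyGE a n hn).of_mono (K.iCycles n))
  obtain hn | hn := lt_or_ge n a
  · exact of_lt n hn
  · induction n, hn using Int.leInduction with
    | base => exact (extAcyclic_boundaries_and_cycles_of_pred hX hH a (of_lt _ (by simp))).2
    | succ n _ ih =>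
      exact (extAcyclic_boundaries_and_cycles_of_pred hX hH (n + 1) (by simpa using ih)).2

lemma extAcyclic_boundaries : ExtAcyclic E (boundariesCycles K n).X₁ :=
  (extAcyclic_boundaries_and_cycles_of_pred hX hH n (extAcyclic_cycles hK hX hH _)).1

lemma preservesLeftHomologyOf_sc_of_extAcyclic {R : Type u} [Ring R] {G : A ⥤ ModuleCat.{u} R}
    [G.PreservesZeroMorphisms] [PreservesFiniteLimits G]
    (h : (G ⋙ forget _).CorepresentableBy E) : G.PreservesLeftHomologyOf (K.sc n) := by
  refine preservesLeftHomologyOf_sc_of_exact_of_epi K G ?_ ?_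
  · refine (exact_map_iff_of_corepresentableBy h _).2 fun f hf ↦ ?_
    obtain ⟨k, hk⟩ := ExtAcyclic.exists_lift (cyclesBoundaries_shortExact K rfl (by simp))
      (extAcyclic_cycles hK hX hH _) (kernel.lift (K.homologyπ n) f hf)
    refine ⟨k, ?_⟩
    dsimp [cyclesBoundaries] at k hk ⊢
    rw [← kernel.lift_ι (K.homologyπ n) f hf, ← hk, Category.assoc, kernel.lift_ι]
  · exact (epi_map_iff_of_corepresentableBy h _).2 <|
      ExtAcyclic.exists_lift (boundariesCycles_shortExact K n) (extAcyclic_boundaries hK hX hH n)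

end AcyclicComplexes

section MapNatTrans

variable {C D : Type*} [Category* C] [Category* D] [Abelian C] [Abelian D]
  {F G : C ⥤ D} [F.PreservesZeroMorphisms] [G.PreservesZeroMorphisms]

lemma isIso_homologyMap_mapNatTrans (τ : F ⟶ G) (S : ShortComplex C)
    [F.PreservesLeftHomologyOf S] [G.PreservesLeftHomologyOf S] [IsIso (τ.app S.homology)] :
    IsIso (ShortComplex.homologyMap (S.mapNatTrans τ)) := by
  rw [(ShortComplex.LeftHomologyMapData.natTransApp S.homologyData.left τ).homologyMap_eq]
  have : IsIso (ShortComplex.LeftHomologyMapData.natTransApp S.homologyData.left τ).φH :=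
    inferInstanceAs (IsIso (τ.app S.homology))
  infer_instance

lemma isIso_map_homologyMap_iff [F.PreservesHomology] {S T : ShortComplex C} (φ : S ⟶ T) :
    IsIso (F.map (ShortComplex.homologyMap φ)) ↔
      IsIso (ShortComplex.homologyMap (F.mapShortComplex.map φ)) :=
  (MorphismProperty.isomorphisms D).arrow_mk_iso_iff
    (Arrow.isoMk (S.mapHomologyIso F).symm (T.mapHomologyIso F).symm
      (by simpa using! (ShortComplex.mapHomologyIso_inv_naturality φ F).symm))

lemma preservesLeftHomologyOf_of_natIso (e : F ≅ G) (S : ShortComplex C)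
    [F.PreservesLeftHomologyOf S] : G.PreservesLeftHomologyOf S where
  isPreservedBy h :=
    have := Functor.PreservesLeftHomologyOf.isPreservedBy (F := F) h
    { g :=
        have := this.g
        preservesLimit_of_natIso _ e
      f' :=
        have := this.f'
        preservesColimit_of_natIso _ e }

end MapNatTrans

/-! ### Sheaves and representations on a stratified space -/

namespace QuiverRep

variable {R : Type u} [CommRing R] {Q : Type u} [Quiver.{0} Q] (ρ : Set (Relation R Q))

instance : PreservesFiniteColimits (satisfies ρ).ι :=
  (satisfies ρ).ι.preservesFiniteColimits_of_preservesHomology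

instance preservesFiniteLimits_stalk (x : Paths Q) : PreservesFiniteLimits (stalk ρ x) :=
  have : PreservesFiniteLimits ((evaluation (Paths Q) (ModuleCat.{u} R)).obj x) :=
    ⟨fun _ _ _ ↦ inferInstance⟩
  comp_preservesFiniteLimits _ _

instance preservesFiniteColimits_stalk (x : Paths Q) : PreservesFiniteColimits (stalk ρ x) :=
  have : PreservesFiniteColimits ((evaluation (Paths Q) (ModuleCat.{u} R)).obj x) :=
    ⟨fun _ _ _ ↦ inferInstance⟩
  comp_preservesFiniteColimits _ _

instance additive_stalk (x : Paths Q) : (stalk ρ x).Additive :=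
  Functor.additive_of_preserves_binary_products _

lemma isIso_of_isIso_stalk_map {V W : RepRel ρ} (f : V ⟶ W)
    (hf : ∀ x, IsIso ((stalk ρ x).map f)) : IsIso f := by
  have : IsIso ((satisfies ρ).ι.map f) := by
    rw [NatTrans.isIso_iff_isIso_app]
    exact hf
  exact isIso_of_reflects_iso f (satisfies ρ).ι

lemma epi_of_epi_stalk_map {V W : RepRel ρ} (f : V ⟶ W)
    (hf : ∀ x, Epi ((stalk ρ x).map f)) : Epi f := by
  apply (satisfies ρ).ι.epi_of_epi_map
  rw [NatTrans.epi_iff_epi_app]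
  exact hf

instance : (finiteStalks ρ).IsClosedUnderIsomorphisms where
  of_iso e h x :=
    have : Module.Finite R ((stalk ρ x).obj _) := h x
    Module.Finite.equiv ((stalk ρ x).mapIso e).toLinearEquiv

lemma actRelation_single_sub_single (V : Rep R Q) {x y : Paths Q} (p q : x ⟶ y) :
    actRelation V ⟨x, y, Finsupp.single p 1 - Finsupp.single q 1⟩ = V.map p - V.map q := by
  simp only [actRelation]
  rw [Finsupp.sum_sub_index (by intros; rw [sub_smul])]
  simp

end QuiverRep

namespace SheafMod

variable {R : Type u} [CommRing R] {X : TopCat.{u}}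

/-- The functor that takes the stalk of a sheaf at `x`. -/
abbrev stalkAt (x : X) : Sh R X ⥤ ModuleCat.{u} R :=
  TopCat.Sheaf.forget _ X ⋙ TopCat.Presheaf.stalkFunctor _ x

/-- The natural transformation that takes the germ at `x` of a section on a neighbourhood `U`. -/
def germAt {U : Opens X} {x : X} (hx : x ∈ U) : sections R U ⟶ stalkAt x where
  app F := F.presheaf.germ U x hx
  naturality _ _ f := (TopCat.Presheaf.stalkFunctor_map_germ _ _ _ f.hom).symm

lemma isIso_of_isIso_stalkAt_map {F G : Sh R X} (f : F ⟶ G)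
    (hf : ∀ x, IsIso ((stalkAt x).map f)) : IsIso f :=
  (TopCat.Presheaf.isIso_iff_stalkFunctor_map_iso f).2 hf

end SheafMod

namespace Stratification

open SheafMod QuiverRep

variable {X : TopCat.{u}} (𝒮 : Stratification X)

lemma subset_closure_of_mem_star {S T : 𝒮.Vertex} {x : X} (hx : x ∈ S.1) (hT : x ∈ 𝒮.star T) :
    T.1 ⊆ closure S.1 := by
  obtain ⟨T', ⟨hT', hTT'⟩, hx'⟩ := hT
  obtain rfl : S.1 = T' := (𝒮.isPartition.2 x).unique ⟨S.2, hx⟩ ⟨hT', hx'⟩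
  exact hTT'

lemma exists_vertex_mem (x : X) : ∃ S : 𝒮.Vertex, x ∈ S.1 := by
  obtain ⟨T, ⟨hT, hx⟩, -⟩ := 𝒮.isPartition.2 x
  exact ⟨⟨T, hT⟩, hx⟩

lemma exists_mem_vertex (S : 𝒮.Vertex) : ∃ x : X, x ∈ S.1 :=
  Set.nonempty_iff_ne_empty.2 fun h ↦ 𝒮.isPartition.1 (h ▸ S.2)

instance : Finite 𝒮.Vertex := 𝒮.finite

/-- The path of length one given by the inclusion of a stratum in the closure of another one. -/
def path {S T : Paths 𝒮.Vertex} (h : S.1 ⊆ closure T.1) : S ⟶ T :=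
  (Paths.of 𝒮.Vertex).map (X := S) (Y := T) ⟨h⟩

lemma subset_closure_of_path {S T : Paths 𝒮.Vertex} (p : S ⟶ T) : S.1 ⊆ closure T.1 := by
  refine Paths.induction_fixed_source (fun {T} _ ↦ S.1 ⊆ closure T.1) subset_closure ?_ p
  intro U T p e ih
  exact ih.trans (closure_minimal e.down isClosed_closure)

section

variable {R : Type u} [CommRing R]

variable {𝒮} in
lemma map_eq_map_of_repStrata (V : 𝒮.RepStrata R) {S T : Paths 𝒮.Vertex} (p q : S ⟶ T) :
    V.obj.map p = V.obj.map q :=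
  sub_eq_zero.1 ((actRelation_single_sub_single _ p q).symm.trans
    (V.property _ ⟨S, T, p, q, rfl⟩))

/-- The presheaf `P` vanishes on the stars of the strata outside the closure of `S`, and on the
stars of the strata in the closure of `S` it has the same sections as on the star of `S`. This
holds for the direct image of a sheaf on `S`, and for skyscrapers at the points of `S`. -/
structure IsSupportedBelow (P : TopCat.Presheaf (ModuleCat.{u} R) X) (S : 𝒮.Vertex) : Prop where
  isZero : ∀ T : 𝒮.Vertex, ¬ T.1 ⊆ closure S.1 → IsZero (P.obj (op (𝒮.star T)))
  isIso : ∀ (T : 𝒮.Vertex) (h : T.1 ⊆ closure S.1),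
    IsIso (P.map (homOfLE (𝒮.star_le h)).op)

namespace IsSupportedBelow

variable {𝒮} {P : TopCat.Presheaf (ModuleCat.{u} R) X} {S : Paths 𝒮.Vertex}
  (hP : 𝒮.IsSupportedBelow P S)

include hP in
lemma isIso_map_path {T : Paths 𝒮.Vertex} (h : T.1 ⊆ closure S.1) :
    IsIso ((𝒮.starFunctor ⋙ P).map (𝒮.path h)) :=
  (congr_arg P.map (Subsingleton.elim _ _) :
    _ = (𝒮.starFunctor ⋙ P).map (𝒮.path h)) ▸ hP.isIso T h

variable {V : 𝒮.RepStrata R}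

include hP in
lemma hom_ext {f g : V.obj ⟶ 𝒮.starFunctor ⋙ P} (h : f.app S = g.app S) : f = g := by
  ext T : 2
  by_cases hT : T.1 ⊆ closure S.1
  · have := hP.isIso_map_path hT
    rw [← cancel_mono ((𝒮.starFunctor ⋙ P).map (𝒮.path hT)), ← f.naturality, ← g.naturality, h]
  · exact (hP.isZero T hT).eq_of_tgt _ _

open Classical in
/-- The component at `T` of the unique morphism of representations with component `a` at `S`. -/
def extendApp (a : V.obj.obj S ⟶ (𝒮.starFunctor ⋙ P).obj S) (T : Paths 𝒮.Vertex) :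
    V.obj.obj T ⟶ (𝒮.starFunctor ⋙ P).obj T :=
  if h : T.1 ⊆ closure S.1 then
    haveI := hP.isIso_map_path h
    V.obj.map (𝒮.path h) ≫ a ≫ inv ((𝒮.starFunctor ⋙ P).map (𝒮.path h))
  else 0

lemma extendApp_comp_map (a : V.obj.obj S ⟶ (𝒮.starFunctor ⋙ P).obj S) {T : Paths 𝒮.Vertex}
    (p : T ⟶ S) :
    hP.extendApp a T ≫ (𝒮.starFunctor ⋙ P).map p = V.obj.map p ≫ a := by
  have h := 𝒮.subset_closure_of_path p
  have := hP.isIso_map_path h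
  have hp : (𝒮.starFunctor ⋙ P).map p = (𝒮.starFunctor ⋙ P).map (𝒮.path h) :=
    congr_arg P.map (Subsingleton.elim _ _)
  rw [extendApp, dif_pos h, hp, map_eq_map_of_repStrata V p (𝒮.path h)]
  simp only [Category.assoc, IsIso.inv_hom_id, Category.comp_id]

lemma extendApp_naturality (a : V.obj.obj S ⟶ (𝒮.starFunctor ⋙ P).obj S)
    {T T' : Paths 𝒮.Vertex} (p : T ⟶ T') :
    V.obj.map p ≫ hP.extendApp a T' = hP.extendApp a T ≫ (𝒮.starFunctor ⋙ P).map p := by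
  by_cases h' : T'.1 ⊆ closure S.1
  · have := hP.isIso_map_path h'
    rw [← cancel_mono ((𝒮.starFunctor ⋙ P).map (𝒮.path h')), Category.assoc, Category.assoc,
      extendApp_comp_map, ← Functor.map_comp, extendApp_comp_map, ← Functor.map_comp_assoc]
  · exact (hP.isZero T' h').eq_of_tgt _ _

include hP in
lemma bijective_app (V : 𝒮.RepStrata R) :
    Function.Bijective fun f : V.obj ⟶ 𝒮.starFunctor ⋙ P ↦ f.app S where
  left _ _ h := hP.hom_ext h
  right a := ⟨{ app := hP.extendApp a, naturality _ _ := hP.extendApp_naturality a },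
    by simpa using hP.extendApp_comp_map a (𝟙 S)⟩

end IsSupportedBelow

open Classical in
lemma isSupportedBelow_skyscraperPresheaf (M : ModuleCat.{u} R) {S : 𝒮.Vertex} {x : X}
    (hx : x ∈ S.1) : 𝒮.IsSupportedBelow (skyscraperPresheaf x M) S where
  isZero T hT := by
    have : x ∉ 𝒮.star T := fun h ↦ hT (𝒮.subset_closure_of_mem_star hx h)
    exact ((if_neg this).symm.ndrec terminalIsTerminal : IsTerminal _).isZero
  isIso T hT := by
    have : x ∈ 𝒮.star S := 𝒮.mem_star hx
    rw [skyscraperPresheaf_map, dif_pos this]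
    exact (eqToIso (C := ModuleCat.{u} R) (by
      rw [skyscraperPresheaf_obj, skyscraperPresheaf_obj, if_pos this,
        if_pos (𝒮.star_le hT this)])).isIso_hom

/-- The inclusion of a stratum. -/
abbrev incl (S : 𝒮.Vertex) : TopCat.of S.1 ⟶ X :=
  TopCat.ofHom (⟨Subtype.val, continuous_subtype_val⟩ : C(S.1, X))

lemma isSupportedBelow_pushforward (S : 𝒮.Vertex) (G : Sh R (TopCat.of S.1)) :
    𝒮.IsSupportedBelow ((TopCat.Sheaf.pushforward _ (𝒮.incl S)).obj G).presheaf S where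
  isZero T hT := by
    have : (Opens.map (𝒮.incl S)).obj (𝒮.star T) = ⊥ :=
      le_bot_iff.1 fun x hx ↦ hT (𝒮.subset_closure_of_mem_star x.2 hx)
    exact (G.isTerminalOfEqEmpty this).isZero
  isIso T hT := by
    have h : (Opens.map (𝒮.incl S)).obj (𝒮.star T) ≤ (Opens.map (𝒮.incl S)).obj (𝒮.star S) :=
      fun x _ ↦ 𝒮.mem_star x.2
    have : IsIso ((Opens.map (𝒮.incl S)).op.map (homOfLE (𝒮.star_le hT)).op) :=
      ⟨(homOfLE h).op, Subsingleton.elim _ _, Subsingleton.elim _ _⟩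
    exact inferInstanceAs (IsIso (G.presheaf.map _))

end
end Stratification

namespace Stratification

open SheafMod QuiverRep

variable {X : TopCat.{u}} (𝒮 : Stratification X)

section

variable (R : Type u) [CommRing R]

/-- The left adjoint of `toRep`: the left Kan extension along the stars, followed by
sheafification. -/
def ofRep : 𝒮.RepStrata R ⥤ Sh R X :=
  (satisfies (𝒮.relations R)).ι ⋙ 𝒮.starFunctor.lan ⋙
    presheafToSheaf (Opens.grothendieckTopology X) (ModuleCat.{u} R)

/-- The adjunction between `ofRep` and `toRep`. -/
def repAdjunction : 𝒮.ofRep R ⊣ 𝒮.toRep R :=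
  ((𝒮.starFunctor.lanAdjunction (ModuleCat.{u} R)).comp
    (sheafificationAdjunction (Opens.grothendieckTopology X)
      (ModuleCat.{u} R))).restrictFullyFaithful
        (satisfies (𝒮.relations R)).fullyFaithfulι (Functor.FullyFaithful.id _)
        (Iso.refl _) (Iso.refl _)

variable {R}

/-- The stalk of a representation at the stratum `S`, as a functor. -/
def repStalk (S : 𝒮.Vertex) : 𝒮.RepStrata R ⥤ ModuleCat.{u} R := stalk (𝒮.relations R) S

instance (S : 𝒮.Vertex) : PreservesFiniteLimits (𝒮.repStalk (R := R) S) :=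
  preservesFiniteLimits_stalk _ _

instance (S : 𝒮.Vertex) : PreservesFiniteColimits (𝒮.repStalk (R := R) S) :=
  preservesFiniteColimits_stalk _ _

instance (S : 𝒮.Vertex) : (𝒮.repStalk (R := R) S).Additive :=
  additive_stalk _ _

/-- The stalk at `S` of the representation attached to a sheaf consists of the sections on the
star of `S`. -/
def toRepCompStalkIso (S : 𝒮.Vertex) : 𝒮.toRep R ⋙ 𝒮.repStalk S ≅ sections R (𝒮.star S) :=
  Iso.refl _

/-- The map from the stalk at `S` of a representation to the sections of the associated sheaf on
the star of `S`. -/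
def toSections (S : 𝒮.Vertex) : 𝒮.repStalk (R := R) S ⟶ 𝒮.ofRep R ⋙ sections R (𝒮.star S) :=
  Functor.whiskerRight (𝒮.repAdjunction R).unit (𝒮.repStalk S) ≫
    Functor.whiskerLeft (𝒮.ofRep R) (𝒮.toRepCompStalkIso S).hom

lemma homEquiv_repAdjunction_app {V : 𝒮.RepStrata R} {G : Sh R X} (f : (𝒮.ofRep R).obj V ⟶ G)
    (S : 𝒮.Vertex) :
    (𝒮.repStalk S).map ((𝒮.repAdjunction R).homEquiv V G f) ≫
      (𝒮.toRepCompStalkIso S).hom.app G =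
        (𝒮.toSections S).app V ≫ (sections R (𝒮.star S)).map f := by
  rw [Adjunction.homEquiv_unit, Functor.map_comp]
  rfl

variable {𝒮} in
lemma IsSupportedBelow.bijective_toSections_comp {G : Sh R X} {S : 𝒮.Vertex}
    (hG : 𝒮.IsSupportedBelow G.presheaf S) (V : 𝒮.RepStrata R) :
    Function.Bijective fun f : (𝒮.ofRep R).obj V ⟶ G ↦
      (𝒮.toSections S).app V ≫ (sections R (𝒮.star S)).map f := by
  convert! (hG.bijective_app V).comp (InducedCategory.homEquiv.bijective.comp
    ((𝒮.repAdjunction R).homEquiv V G).bijective) using 1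

/-- The map from the stalk at `S` of a representation to the stalk of the associated sheaf at a
point of `S`. -/
def toStalk {S : 𝒮.Vertex} {x : X} (hx : x ∈ S.1) :
    𝒮.repStalk (R := R) S ⟶ 𝒮.ofRep R ⋙ stalkAt x :=
  𝒮.toSections S ≫ Functor.whiskerLeft (𝒮.ofRep R) (germAt (𝒮.mem_star hx))

open StalkSkyscraperPresheafAdjunctionAuxs in
instance isIso_toStalk {S : 𝒮.Vertex} {x : X} (hx : x ∈ S.1) :
    IsIso (𝒮.toStalk (R := R) hx) := by
  classical
  refine @NatIso.isIso_of_isIso_app _ _ _ _ _ _ _ fun V ↦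
    isIso_of_coyoneda_map_bijective _ fun M ↦ ?_
  let adj (f : (𝒮.ofRep R).obj V ⟶ skyscraperSheaf x M) :
    (𝒮.ofRep R ⋙ stalkAt x).obj V ⟶ M := fromStalk x f.hom
  have bijective_adj : Function.Bijective adj :=
    Function.bijective_iff_has_inverse.2 ⟨fun g ↦ ⟨toSkyscraperPresheaf x g⟩,
      fun f ↦ InducedCategory.hom_ext (to_skyscraper_fromStalk x f.hom),
      fun g ↦ fromStalk_to_skyscraper x g⟩
  let e : (sections R (𝒮.star S)).obj (skyscraperSheaf x M) ≅ M :=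
    eqToIso (if_pos (𝒮.mem_star hx))
  have germ_adj (f : (𝒮.ofRep R).obj V ⟶ skyscraperSheaf x M) :
      (germAt (𝒮.mem_star hx)).app _ ≫ adj f = (sections R (𝒮.star S)).map f ≫ e.hom :=
    germ_fromStalk x f.hom _ (𝒮.mem_star hx)
  rw [← Function.Bijective.of_comp_iff _ bijective_adj]
  convert! (Iso.homCongr (Iso.refl ((𝒮.repStalk S).obj V)) e).bijective.comp
    (IsSupportedBelow.bijective_toSections_comp (G := skyscraperSheaf x M)
      (𝒮.isSupportedBelow_skyscraperPresheaf M hx) V) using 1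
  funext f
  simp only [toStalk, Function.comp_apply, Iso.homCongr_apply, Iso.refl_inv, Category.id_comp,
    NatTrans.comp_app, Category.assoc, Functor.whiskerLeft_app, germ_adj]

instance : (𝒮.ofRep R).Additive := (𝒮.repAdjunction R).left_adjoint_additive

instance : PreservesFiniteColimits (𝒮.ofRep R) :=
  have := (𝒮.repAdjunction R).leftAdjoint_preservesColimits
  inferInstance

lemma exact_map_ofRep {C : ShortComplex (𝒮.RepStrata R)} (hC : C.Exact) :
    (C.map (𝒮.ofRep R)).Exact := by
  rw [TopCat.Sheaf.exact_iff_stalkFunctor_map_exact]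
  intro x
  obtain ⟨S, hx⟩ := 𝒮.exists_vertex_mem x
  exact (ShortComplex.exact_iff_of_iso
    (C.mapNatIso (asIso (𝒮.toStalk hx)))).1 (hC.map (𝒮.repStalk S))

instance : (𝒮.ofRep R).PreservesHomology :=
  ((𝒮.ofRep R).exact_tfae.out 1 2).1 fun _ h ↦ 𝒮.exact_map_ofRep h

instance : PreservesFiniteLimits (𝒮.ofRep R) :=
  (𝒮.ofRep R).preservesFiniteLimits_of_preservesHomology

instance : (𝒮.ofRep R).ReflectsIsomorphisms where
  reflects {V W} f hf := by
    refine isIso_of_isIso_stalk_map _ f fun S : 𝒮.Vertex ↦ ?_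
    obtain ⟨x, hx⟩ := 𝒮.exists_mem_vertex S
    exact (NatIso.isIso_map_iff (asIso (𝒮.toStalk hx)) f).2
      (inferInstanceAs (IsIso ((stalkAt x).map ((𝒮.ofRep R).map f))))

instance (S : 𝒮.Vertex) : PreservesFiniteLimits (sections R (𝒮.star S)) :=
  have : PreservesFiniteLimits (𝒮.toRep R) :=
    have := (𝒮.repAdjunction R).rightAdjoint_preservesLimits
    inferInstance
  preservesFiniteLimits_of_natIso (𝒮.toRepCompStalkIso S)

lemma toStalk_app_comp_map_counit (F : Sh R X) {S : 𝒮.Vertex} {x : X} (hx : x ∈ S.1) :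
    (𝒮.toStalk hx).app ((𝒮.toRep R).obj F) ≫
      (stalkAt x).map ((𝒮.repAdjunction R).counit.app F) =
        (𝒮.toRepCompStalkIso S).hom.app F ≫ (germAt (𝒮.mem_star hx)).app F := by
  have h := 𝒮.homEquiv_repAdjunction_app ((𝒮.repAdjunction R).counit.app F) S
  rw [Adjunction.homEquiv_unit, Adjunction.right_triangle_components,
    CategoryTheory.Functor.map_id, Category.id_comp] at h
  rw [toStalk, NatTrans.comp_app, Category.assoc]
  refine (congr_arg (_ ≫ ·) ((germAt _).naturality _).symm).trans ?_
  exact (Category.assoc _ _ _).symm.trans (congr_arg (· ≫ _) h.symm)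

variable {𝒮} in
lemma IsAcyclic.isIso_repAdjunction_counit_app (h𝒮 : 𝒮.IsAcyclic R) (F : Sh R X)
    (hF : 𝒮.weaklyConstructible F) : IsIso ((𝒮.repAdjunction R).counit.app F) := by
  refine isIso_of_isIso_stalkAt_map _ fun x ↦ ?_
  obtain ⟨S, hx⟩ := 𝒮.exists_vertex_mem x
  have : IsIso ((germAt (𝒮.mem_star hx)).app F) := h𝒮.isIso_germ F hF S x hx
  have : IsIso ((𝒮.toStalk hx).app ((𝒮.toRep R).obj F) ≫
      (stalkAt x).map ((𝒮.repAdjunction R).counit.app F)) := by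
    rw [toStalk_app_comp_map_counit]
    infer_instance
  exact IsIso.of_isIso_comp_left ((𝒮.toStalk hx).app ((𝒮.toRep R).obj F)) _

/-- The inverse image of the star of `S` in `S` is the whole of `S`. -/
def isTerminalPreimageStar (S : 𝒮.Vertex) :
    IsTerminal ((Opens.map (𝒮.incl S)).obj (𝒮.star S)) :=
  IsTerminal.ofUniqueHom (fun _ ↦ homOfLE fun x _ ↦ 𝒮.mem_star x.2)
    fun _ _ ↦ Subsingleton.elim _ _

/-- The map from the constant sheaf on `S` with the stalk of the representation `V` to the
restriction to `S` of the sheaf associated to `V`. -/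
def constantToPullback (V : 𝒮.RepStrata R) (S : 𝒮.Vertex) :
    (constantSheaf (Opens.grothendieckTopology (TopCat.of S.1)) _).obj ((𝒮.repStalk S).obj V) ⟶
      (TopCat.Sheaf.pullback _ (𝒮.incl S)).obj ((𝒮.ofRep R).obj V) :=
  ((constantSheafAdj _ _ (𝒮.isTerminalPreimageStar S)).homEquiv _ _).symm
    ((𝒮.toSections S).app V ≫ (sections R (𝒮.star S)).map
      ((TopCat.Sheaf.pullbackPushforwardAdjunction _ (𝒮.incl S)).unit.app _))

instance isIso_constantToPullback (V : 𝒮.RepStrata R) (S : 𝒮.Vertex) :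
    IsIso (𝒮.constantToPullback V S) := by
  let adj := constantSheafAdj (Opens.grothendieckTopology (TopCat.of S.1)) (ModuleCat.{u} R)
    (𝒮.isTerminalPreimageStar S)
  let adj' := TopCat.Sheaf.pullbackPushforwardAdjunction (ModuleCat.{u} R) (𝒮.incl S)
  refine isIso_of_coyoneda_map_bijective _ fun G ↦ ?_
  have constantToPullback_comp (f : (TopCat.Sheaf.pullback (ModuleCat.{u} R) (𝒮.incl S)).obj
      ((𝒮.ofRep R).obj V) ⟶ G) : 𝒮.constantToPullback V S ≫ f = (adj.homEquiv _ G).symm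
        ((𝒮.toSections S).app V ≫ (sections R (𝒮.star S)).map (adj'.homEquiv _ G f)) := by
    refine (adj.homEquiv_naturality_right_symm _ f).symm.trans (congr_arg _ ?_)
    refine (Category.assoc _ _ _).trans (congr_arg (_ ≫ ·) ?_)
    exact ((sections R (𝒮.star S)).map_comp _ _).symm.trans
      (congr_arg _ (adj'.homEquiv_unit _ _ _).symm)
  refine (congr_arg Function.Bijective (funext constantToPullback_comp)).mpr
    ((adj.homEquiv _ G).symm.bijective.comp
      (((𝒮.isSupportedBelow_pushforward S G).bijective_toSections_comp V).comp
        (adj'.homEquiv _ G).bijective))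

lemma weaklyConstructible_ofRep_obj (V : 𝒮.RepStrata R) :
    𝒮.weaklyConstructible ((𝒮.ofRep R).obj V) :=
  fun S hS ↦ Sheaf.isConstant_of_iso _
    (@asIso _ _ _ _ _ (𝒮.isIso_constantToPullback V ⟨S, hS⟩)).symm

instance : (𝒮.weaklyConstructible (R := R)).IsClosedUnderIsomorphisms where
  of_iso e h S hS :=
    have := h S hS
    Sheaf.isConstant_congr _ ((TopCat.Sheaf.pullback _ _).mapIso e)

instance : (𝒮.constructible (R := R)).IsClosedUnderIsomorphisms where
  of_iso {F _} e h := ⟨ObjectProperty.prop_of_iso _ e h.1, fun x ↦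
    have : Module.Finite R ((stalkAt x).obj F) := h.2 x
    Module.Finite.equiv ((stalkAt x).mapIso e).toLinearEquiv⟩

lemma constructible_ofRep_obj_iff (V : 𝒮.RepStrata R) :
    𝒮.constructible ((𝒮.ofRep R).obj V) ↔ finiteStalks (𝒮.relations R) V := by
  have e {S : 𝒮.Vertex} {x : X} (hx : x ∈ S.1) :
      (𝒮.repStalk S).obj V ≃ₗ[R] ((𝒮.ofRep R).obj V).presheaf.stalk x :=
    (asIso ((𝒮.toStalk hx).app V)).toLinearEquiv
  refine ⟨fun h S ↦ ?_, fun h ↦ ⟨𝒮.weaklyConstructible_ofRep_obj V, fun x ↦ ?_⟩⟩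
  · obtain ⟨x, hx⟩ := 𝒮.exists_mem_vertex S
    exact @Module.Finite.equiv _ _ _ _ _ _ _ _ (h.2 x) (e hx).symm
  · obtain ⟨S, hx⟩ := 𝒮.exists_vertex_mem x
    exact @Module.Finite.equiv _ _ _ _ _ _ _ _ (h S) (e hx)

end
end Stratification

namespace Stratification

open SheafMod QuiverRep

variable {X : TopCat.{u}} (𝒮 : Stratification X)

section

variable (R : Type u) [CommRing R]

/-- The type-valued functor that is a point on the strata whose closure contains `S`, and empty on
the others. -/
def above (S : Paths 𝒮.Vertex) : Paths 𝒮.Vertex ⥤ Type u where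
  obj T := ULift.{u} (PLift (S.1 ⊆ closure T.1))
  map p := TypeCat.ofHom fun h ↦
    ⟨⟨h.down.down.trans (closure_minimal (𝒮.subset_closure_of_path p) isClosed_closure)⟩⟩

instance (S T : Paths 𝒮.Vertex) : Subsingleton ((𝒮.above S).obj T) :=
  inferInstanceAs (Subsingleton (ULift (PLift (S.1 ⊆ closure T.1))))

lemma above_map_eq_map (S : Paths 𝒮.Vertex) {T U : Paths 𝒮.Vertex} (p q : T ⟶ U) :
    (𝒮.above S).map p = (𝒮.above S).map q := by
  ext
  exact Subsingleton.elim (α := (𝒮.above S).obj U) _ _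

/-- The representation that is `R` on the strata whose closure contains `S`, and zero on the others:
it is projective, because it corepresents the stalk at `S`. -/
def projRep (S : Paths 𝒮.Vertex) : 𝒮.RepStrata R where
  obj := 𝒮.above S ⋙ ModuleCat.free R
  property := by
    rintro _ ⟨T, U, p, q, rfl⟩
    rw [actRelation_single_sub_single, Functor.comp_map, Functor.comp_map,
      𝒮.above_map_eq_map S p q, sub_self]

/-- The generator of `projRep` at the stratum `S`. -/
def projRepGen (S : Paths 𝒮.Vertex) : (stalk _ S).obj (𝒮.projRep R S) :=
  ModuleCat.freeMk (R := R) (X := (𝒮.above S).obj S) ⟨⟨subset_closure⟩⟩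

lemma hom_app_freeMk {S T : Paths 𝒮.Vertex} {V : 𝒮.RepStrata R} (f : 𝒮.projRep R S ⟶ V)
    (h : (𝒮.above S).obj T) :
    (f.hom.app T).hom (ModuleCat.freeMk (R := R) h) =
      (V.obj.map (𝒮.path h.down.down)).hom ((f.hom.app S).hom (𝒮.projRepGen R S)) := by
  have map_gen : ((𝒮.projRep R S).obj.map (𝒮.path h.down.down)).hom (𝒮.projRepGen R S) =
      ModuleCat.freeMk (R := R) h :=
    (ModuleCat.free_map_apply ((𝒮.above S).map (𝒮.path h.down.down)) _).trans
      (congr_arg _ (Subsingleton.elim (α := (𝒮.above S).obj T) _ _))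
  rw [← map_gen]
  exact ConcreteCategory.congr_hom (f.hom.naturality (𝒮.path h.down.down)) (𝒮.projRepGen R S)

variable {R}

/-- The morphism from `projRep` that sends the generator to `v`. -/
def projRepDesc {S : Paths 𝒮.Vertex} {V : 𝒮.RepStrata R} (v : (stalk _ S).obj V) :
    𝒮.projRep R S ⟶ V where
  hom :=
    { app T := ModuleCat.freeDesc (TypeCat.ofHom fun h : (𝒮.above S).obj T ↦
        (V.obj.map (𝒮.path h.down.down)).hom v)
      naturality T U p := by
        refine ModuleCat.free_hom_ext fun h ↦ ?_
        simp [projRep, ← map_eq_map_of_repStrata V (𝒮.path h.down.down ≫ p)] }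

lemma projRepDesc_app_projRepGen {S : Paths 𝒮.Vertex} {V : 𝒮.RepStrata R}
    (v : (stalk _ S).obj V) :
    ((𝒮.projRepDesc v).hom.app S).hom (𝒮.projRepGen R S) = v := by
  have h : (V.obj.map (𝒮.path (S := S) (T := S) subset_closure)).hom v = v := by
    rw [map_eq_map_of_repStrata V _ (𝟙 S), V.obj.map_id]
    rfl
  exact (ModuleCat.freeDesc_apply (R := R) (X := (𝒮.above S).obj S)
    (M := V.obj.obj S) _ _).trans h

variable (R)

/-- The stalk at `S` is corepresented by `projRep`. -/
def repStalkCorepresentableBy (S : 𝒮.Vertex) :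
    (𝒮.repStalk S ⋙ forget _).CorepresentableBy (𝒮.projRep R S) where
  homEquiv {V} :=
    { toFun f := (f.hom.app S).hom (𝒮.projRepGen R S)
      invFun v := 𝒮.projRepDesc v
      left_inv f := by
        ext T : 3
        refine ModuleCat.free_hom_ext (R := R) (X := (𝒮.above S).obj T) fun h ↦ ?_
        exact (𝒮.hom_app_freeMk R _ h).trans ((congr_arg (V.obj.map (𝒮.path h.down.down)).hom
          (𝒮.projRepDesc_app_projRepGen _)).trans (𝒮.hom_app_freeMk R f h).symm)
      right_inv v := 𝒮.projRepDesc_app_projRepGen v }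
  homEquiv_comp _ _ := rfl

instance (S : 𝒮.Vertex) : Projective (𝒮.projRep R S) :=
  projective_of_corepresentableBy (𝒮.repStalkCorepresentableBy R S)

/-- The sections on the star of `S` are corepresented by the sheaf associated to `projRep`. -/
def sectionsCorepresentableBy (S : 𝒮.Vertex) :
    (sections R (𝒮.star S) ⋙ forget _).CorepresentableBy ((𝒮.ofRep R).obj (𝒮.projRep R S)) where
  homEquiv {F} := ((𝒮.repAdjunction R).homEquiv _ F).trans
    (𝒮.repStalkCorepresentableBy R S).homEquiv
  homEquiv_comp g f :=
    (congr_arg (𝒮.repStalkCorepresentableBy R S).homEquiv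
      ((𝒮.repAdjunction R).homEquiv_naturality_right f g)).trans
        ((𝒮.repStalkCorepresentableBy R S).homEquiv_comp _ _)

lemma finiteStalks_projRep (S : Paths 𝒮.Vertex) :
    finiteStalks (𝒮.relations R) (𝒮.projRep R S) := fun T ↦ by
  have : Finite ((𝒮.above S).obj T) := Finite.of_subsingleton
  exact inferInstanceAs (Module.Finite R ((𝒮.above S).obj T →₀ R))

variable {R}

lemma epi_of_span_eq_top {V W : 𝒮.RepStrata R} (f : V ⟶ W)
    (s : ∀ S : 𝒮.Vertex, Set ((𝒮.repStalk S).obj W)) (hs : ∀ S, Submodule.span R (s S) = ⊤)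
    (hf : ∀ S, ∀ v ∈ s S, ∃ g : 𝒮.projRep R S ⟶ V, g ≫ f = 𝒮.projRepDesc v) : Epi f := by
  refine epi_of_epi_stalk_map _ f fun S : 𝒮.Vertex ↦ ?_
  rw [ModuleCat.epi_iff_surjective]
  suffices LinearMap.range ((𝒮.repStalk S).map f).hom = ⊤ from LinearMap.range_eq_top.1 this
  rw [eq_top_iff, ← hs S, Submodule.span_le]
  intro v hv
  obtain ⟨g, hg⟩ := hf S v hv
  refine ⟨(g.hom.app S).hom (𝒮.projRepGen R S), ?_⟩
  exact (congr_arg (fun k ↦ (k.hom.app S).hom (𝒮.projRepGen R S)) hg).trans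
    (𝒮.projRepDesc_app_projRepGen v)

variable [IsNoetherianRing R]

lemma exists_epi_projective_obj (M : 𝒮.RepStrataFin R) :
    ∃ (P : 𝒮.RepStrataFin R) (p : P ⟶ M), Epi p ∧ Projective P.obj := by
  choose s hs using fun S : 𝒮.Vertex ↦ (M.property S).fg_top
  let ι := (finiteStalks (𝒮.relations R)).ι
  let P (j : Σ S : 𝒮.Vertex, s S) : 𝒮.RepStrataFin R :=
    ⟨𝒮.projRep R j.1, 𝒮.finiteStalks_projRep R j.1⟩
  let p (j : Σ S : 𝒮.Vertex, s S) : P j ⟶ M := ⟨𝒮.projRepDesc j.2.1⟩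
  refine ⟨∐ P, Sigma.desc p, ι.epi_of_epi_map ?_, ?_⟩
  · refine 𝒮.epi_of_span_eq_top (ι.map (Sigma.desc p))
      (fun S ↦ (s S : Set (M.obj.obj.obj S))) hs fun S v hv ↦ ?_
    exact ⟨ι.map (Sigma.ι P ⟨S, v, hv⟩), (ι.map_comp _ _).symm.trans
      (congr_arg _ (Sigma.ι_desc p ⟨S, v, hv⟩))⟩
  · have (j : Σ S : 𝒮.Vertex, s S) : Projective (ι.obj (P j)) :=
      inferInstanceAs (Projective (𝒮.projRep R j.1))
    have : PreservesColimit (Discrete.functor P) ι :=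
      (inferInstance : PreservesColimitsOfShape (Discrete _) ι).preservesColimit
    exact Projective.of_iso (PreservesCoproduct.iso ι P).symm inferInstance

instance : (finiteStalks (𝒮.relations R)).ι.PreservesProjectiveObjects :=
  preservesProjectiveObjects_of_exists_epi _ 𝒮.exists_epi_projective_obj

instance : EnoughProjectives (𝒮.RepStrataFin R) where
  presentation M := by
    obtain ⟨P, p, _, hP⟩ := 𝒮.exists_epi_projective_obj M
    have : Projective P :=
      (finiteStalks (𝒮.relations R)).ι.projective_of_map_projective hP
    exact ⟨{ p := P, f := p }⟩

end
end Stratification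

/-! ### The derived equivalences -/

namespace Stratification

open SheafMod QuiverRep

variable {X : TopCat.{u}} {𝒮 : Stratification X} {R : Type u} [CommRing R]

/-- The cohomology sheaves of `K` are acyclic on the stars, so `toRep` commutes with taking them,
which reduces the claim to the counit at a single sheaf. -/
lemma IsAcyclic.quasiIso_repAdjunction_counit_app (h𝒮 : 𝒮.IsAcyclic R)
    (K : CochainComplex (Sh R X) ℤ) (hK : CochainComplex.plus _ K) (hX : ∀ n, Injective (K.X n))
    (hH : ∀ n, 𝒮.weaklyConstructible (K.homology n)) :
    QuasiIso ((mapHomologicalComplexAdjunction (𝒮.repAdjunction R) (.up ℤ)).counit.app K) where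
  quasiIsoAt n := by
    have := hasExt_of_enoughInjectives.{u} (Sh R X)
    rw [quasiIsoAt_iff_isIso_homologyMap]
    refine isIso_of_isIso_stalkAt_map _ fun x ↦ ?_
    refine (isIso_map_homologyMap_iff (F := stalkAt (R := R) x) _).2 ?_
    let τ := Functor.whiskerRight (𝒮.repAdjunction R).counit (stalkAt (R := R) x)
    have : IsIso (τ.app (K.sc n).homology) := by
      have := h𝒮.isIso_repAdjunction_counit_app _ (hH n)
      exact inferInstanceAs (IsIso ((stalkAt x).map
        ((𝒮.repAdjunction R).counit.app (K.homology n))))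
    obtain ⟨S, hx⟩ := 𝒮.exists_vertex_mem x
    have : (sections R (𝒮.star S)).PreservesLeftHomologyOf (K.sc n) :=
      preservesLeftHomologyOf_sc_of_extAcyclic hK (fun n ↦ .of_injective _ (K.X n))
        (fun n ↦ .of_isZero_rightDerived (𝒮.sectionsCorepresentableBy R S)
          (h𝒮.isZero_cohomology _ (hH n) S)) n (𝒮.sectionsCorepresentableBy R S)
    have : ((𝒮.toRep R ⋙ 𝒮.ofRep R) ⋙ stalkAt (R := R) x).PreservesLeftHomologyOf (K.sc n) :=
      preservesLeftHomologyOf_of_natIso ((𝒮.toRepCompStalkIso S).symm ≪≫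
        Functor.isoWhiskerLeft (𝒮.toRep R) (asIso (𝒮.toStalk hx)) ≪≫
          (Functor.associator _ _ _).symm) _
    have : (𝟭 (Sh R X) ⋙ stalkAt (R := R) x).PreservesLeftHomologyOf (K.sc n) := inferInstance
    exact isIso_homologyMap_mapNatTrans τ (K.sc n)

variable [HasDerivedCategory.{w₁} (Sh R X)] {P : ObjectProperty (Sh R X)}

instance : (boundedToPlus R X).Full := (ObjectProperty.fullyFaithfulιOfLE _).full

instance : (boundedToPlus R X).Faithful := (ObjectProperty.fullyFaithfulιOfLE _).faithful

lemma cohomologyPlus_boundedToPlus_obj (hP : P ≤ 𝒮.weaklyConstructible)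
    (K : (cohomologyBounded P).FullSubcategory) :
    cohomologyPlus 𝒮.weaklyConstructible ((boundedToPlus R X).obj K.obj) :=
  fun n ↦ hP _ (K.property n)

/-- The inclusion into `D⁺_{w,c}(X)` of the complexes in `Dᵇ(X)` with cohomology in `P`. -/
abbrev boundedToPlusWC (hP : P ≤ 𝒮.weaklyConstructible) :
    (cohomologyBounded P).FullSubcategory ⥤ 𝒮.DPlusWC R :=
  (cohomologyPlus 𝒮.weaklyConstructible).lift ((cohomologyBounded P).ι ⋙ boundedToPlus R X)
    (cohomologyPlus_boundedToPlus_obj hP)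

variable [HasDerivedCategory.{w₂} (𝒮.RepStrata R)]

lemma IsAcyclic.isIso_rightDerivedPlusAdjunction_counit_app (h𝒮 : 𝒮.IsAcyclic R)
    (K : DerivedCategory.Plus (Sh R X)) (hK : cohomologyPlus 𝒮.weaklyConstructible K) :
    IsIso ((rightDerivedPlusAdjunction (𝒮.repAdjunction R)).counit.app K) :=
  _root_.isIso_rightDerivedPlusAdjunction_counit_app _ h𝒮.quasiIso_repAdjunction_counit_app K hK

lemma cohomologyPlus_mapDerivedCategoryPlus_ofRep_obj (V : DerivedCategory.Plus (𝒮.RepStrata R)) :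
    cohomologyPlus 𝒮.weaklyConstructible ((mapDerivedCategoryPlus (𝒮.ofRep R)).obj V) :=
  fun n ↦ ObjectProperty.prop_of_iso _
    ((mapDerivedCategoryCompHomologyFunctorIso (𝒮.ofRep R) n).app V.obj).symm
    (𝒮.weaklyConstructible_ofRep_obj _)

lemma IsAcyclic.isEquivalence_plus (h𝒮 : 𝒮.IsAcyclic R) :
    ((cohomologyPlus 𝒮.weaklyConstructible).ι ⋙
      (𝒮.toRep R).rightDerivedFunctorPlus).IsEquivalence :=
  isEquivalence_ι_comp_of_isIso_counit (rightDerivedPlusAdjunction (𝒮.repAdjunction R))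
    cohomologyPlus_mapDerivedCategoryPlus_ofRep_obj
    h𝒮.isIso_rightDerivedPlusAdjunction_counit_app

variable (𝒮) in
/-- The right derived functor of `toRep` on the complexes in `Dᵇ(X)` with cohomology in `P`. -/
abbrev rightDerivedBounded (P : ObjectProperty (Sh R X)) :
    (cohomologyBounded P).FullSubcategory ⥤ DerivedCategory (𝒮.RepStrata R) :=
  (cohomologyBounded P).ι ⋙ boundedToPlus R X ⋙ (𝒮.toRep R).rightDerivedFunctorPlus ⋙
    DerivedCategory.Plus.ι

lemma IsAcyclic.full_rightDerivedBounded (h𝒮 : 𝒮.IsAcyclic R)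
    (hP : P ≤ 𝒮.weaklyConstructible) : (𝒮.rightDerivedBounded P).Full :=
  have := h𝒮.isEquivalence_plus
  inferInstanceAs (boundedToPlusWC hP ⋙ ((cohomologyPlus 𝒮.weaklyConstructible).ι ⋙
    (𝒮.toRep R).rightDerivedFunctorPlus) ⋙ DerivedCategory.Plus.ι).Full

lemma IsAcyclic.faithful_rightDerivedBounded (h𝒮 : 𝒮.IsAcyclic R)
    (hP : P ≤ 𝒮.weaklyConstructible) : (𝒮.rightDerivedBounded P).Faithful :=
  have := h𝒮.isEquivalence_plus
  inferInstanceAs (boundedToPlusWC hP ⋙ ((cohomologyPlus 𝒮.weaklyConstructible).ι ⋙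
    (𝒮.toRep R).rightDerivedFunctorPlus) ⋙ DerivedCategory.Plus.ι).Faithful

lemma IsAcyclic.bounded_rightDerived_obj_iff (h𝒮 : 𝒮.IsAcyclic R)
    (K : DerivedCategory.Plus (Sh R X)) (hK : cohomologyPlus 𝒮.weaklyConstructible K) :
    DerivedCategory.TStructure.t.bounded ((𝒮.toRep R).rightDerivedFunctorPlus.obj K).obj ↔
      DerivedCategory.TStructure.t.bounded K.obj := by
  have := h𝒮.isIso_rightDerivedPlusAdjunction_counit_app K hK
  rw [← bounded_mapDerivedCategory_obj_iff (𝒮.ofRep R)]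
  exact ObjectProperty.prop_iff_of_iso _ (DerivedCategory.Plus.ι.mapIso
    (asIso ((rightDerivedPlusAdjunction (𝒮.repAdjunction R)).counit.app K)))

lemma IsAcyclic.prop_ofRep_homology_rightDerived_obj_iff (h𝒮 : 𝒮.IsAcyclic R)
    [P.IsClosedUnderIsomorphisms]
    (K : DerivedCategory.Plus (Sh R X)) (hK : cohomologyPlus 𝒮.weaklyConstructible K) (n : ℤ) :
    P ((𝒮.ofRep R).obj ((DerivedCategory.homologyFunctor _ n).obj
        ((𝒮.toRep R).rightDerivedFunctorPlus.obj K).obj)) ↔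
      P ((DerivedCategory.homologyFunctor _ n).obj K.obj) := by
  have := h𝒮.isIso_rightDerivedPlusAdjunction_counit_app K hK
  exact P.prop_iff_of_iso (((mapDerivedCategoryCompHomologyFunctorIso (𝒮.ofRep R) n).app _).symm ≪≫
    (DerivedCategory.homologyFunctor _ n).mapIso (DerivedCategory.Plus.ι.mapIso
      (asIso ((rightDerivedPlusAdjunction (𝒮.repAdjunction R)).counit.app K))))

lemma IsAcyclic.essImage_rightDerivedBounded_iff (h𝒮 : 𝒮.IsAcyclic R)
    [P.IsClosedUnderIsomorphisms] (hP : P ≤ 𝒮.weaklyConstructible)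
    {Q : ObjectProperty (𝒮.RepStrata R)} [Q.IsClosedUnderIsomorphisms]
    (hPQ : ∀ V, P ((𝒮.ofRep R).obj V) ↔ Q V) (Y : DerivedCategory (𝒮.RepStrata R)) :
    (𝒮.rightDerivedBounded P).essImage Y ↔ DerivedCategory.TStructure.t.bounded Y ∧
      ∀ n, Q ((DerivedCategory.homologyFunctor _ n).obj Y) := by
  have homology_iff (K : DerivedCategory.Plus (Sh R X))
      (hK : cohomologyPlus 𝒮.weaklyConstructible K)
      (e : ((𝒮.toRep R).rightDerivedFunctorPlus.obj K).obj ≅ Y) (n : ℤ) :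
      P ((DerivedCategory.homologyFunctor _ n).obj K.obj) ↔
        Q ((DerivedCategory.homologyFunctor _ n).obj Y) :=
    (h𝒮.prop_ofRep_homology_rightDerived_obj_iff K hK n).symm.trans
      ((hPQ _).trans (Q.prop_iff_of_iso ((DerivedCategory.homologyFunctor _ n).mapIso e)))
  constructor
  · rintro ⟨K, ⟨e⟩⟩
    have hK := cohomologyPlus_boundedToPlus_obj hP K
    exact ⟨ObjectProperty.prop_of_iso _ e
        ((h𝒮.bounded_rightDerived_obj_iff _ hK).2 K.obj.property),
      fun n ↦ (homology_iff _ hK e n).1 (K.property n)⟩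
  · rintro ⟨hY, hYQ⟩
    have := h𝒮.isEquivalence_plus
    obtain ⟨K, ⟨e⟩⟩ := Functor.EssSurj.mem_essImage ((cohomologyPlus 𝒮.weaklyConstructible).ι ⋙
      (𝒮.toRep R).rightDerivedFunctorPlus) ⟨Y, hY.1⟩
    have i : ((𝒮.toRep R).rightDerivedFunctorPlus.obj K.obj).obj ≅ Y :=
      DerivedCategory.Plus.ι.mapIso e
    have hK := (h𝒮.bounded_rightDerived_obj_iff K.obj K.property).1
      (ObjectProperty.prop_of_iso _ i.symm hY)
    exact ⟨⟨⟨K.obj.obj, hK⟩, fun n ↦ (homology_iff K.obj K.property i n).2 (hYQ n)⟩, ⟨i⟩⟩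

end Stratification

end

theorem mainTheorem3_general {R : Type u} [CommRing R] [IsNoetherianRing R] (X : TopCat.{u})
    (𝒮 : Stratification X) (h𝒮 : 𝒮.IsAcyclic R)
    [HasDerivedCategory.{w₁} (SheafMod.Sh R X)]
    [HasDerivedCategory.{w₂} (𝒮.RepStrata R)]
    [HasDerivedCategory.{w₃} (𝒮.RepStrataFin R)] :
    ((Stratification.cohomologyPlus 𝒮.weaklyConstructible).ι ⋙
      (𝒮.toRep R).rightDerivedFunctorPlus :
        𝒮.DPlusWC R ⥤ DerivedCategory.Plus (𝒮.RepStrata R)).IsEquivalence ∧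
    (∃ E : 𝒮.DBoundedWC R ≌ DerivedCategory.Bounded (𝒮.RepStrata R),
      Nonempty (E.functor ⋙ DerivedCategory.Bounded.ι ≅
        (Stratification.cohomologyBounded 𝒮.weaklyConstructible).ι ⋙
          Stratification.boundedToPlus R X ⋙
            (𝒮.toRep R).rightDerivedFunctorPlus ⋙ DerivedCategory.Plus.ι)) ∧
    (∃ E : 𝒮.DBoundedC R ≌ DerivedCategory.Bounded (𝒮.RepStrataFin R),
      Nonempty (E.functor ⋙ DerivedCategory.Bounded.ι ⋙
          (QuiverRep.finiteStalks (𝒮.relations R)).ι.mapDerivedCategory ≅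
        (Stratification.cohomologyBounded 𝒮.constructible).ι ⋙
          Stratification.boundedToPlus R X ⋙
            (𝒮.toRep R).rightDerivedFunctorPlus ⋙ DerivedCategory.Plus.ι)) := by
  have hc : 𝒮.constructible (R := R) ≤ 𝒮.weaklyConstructible := fun _ h ↦ h.1
  have := h𝒮.full_rightDerivedBounded le_rfl
  have := h𝒮.faithful_rightDerivedBounded le_rfl
  have := h𝒮.full_rightDerivedBounded hc
  have := h𝒮.faithful_rightDerivedBounded hc
  refine ⟨h𝒮.isEquivalence_plus, exists_equivalence_comp_iso_of_essImage_eq _ _ ?_,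
    exists_equivalence_comp_iso_of_essImage_eq _ _ ?_⟩
  · ext Y
    rw [h𝒮.essImage_rightDerivedBounded_iff le_rfl (Q := ⊤)
      (fun V ↦ iff_of_true (𝒮.weaklyConstructible_ofRep_obj V) trivial)]
    exact ⟨fun h ↦ ⟨⟨Y, h.1⟩, ⟨Iso.refl _⟩⟩,
      fun ⟨Y', ⟨e⟩⟩ ↦ ⟨ObjectProperty.prop_of_iso _ e Y'.property, fun _ ↦ trivial⟩⟩
  · ext Y
    rw [h𝒮.essImage_rightDerivedBounded_iff hc 𝒮.constructible_ofRep_obj_iff,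
      essImage_bounded_mapDerivedCategory_iff]
    refine and_congr_right' (forall_congr' fun n ↦ ?_)
    exact ⟨fun h ↦ ⟨⟨_, h⟩, ⟨Iso.refl _⟩⟩,
      fun ⟨V, ⟨e⟩⟩ ↦ ObjectProperty.prop_of_iso _ e V.property⟩

theorem mainTheorem3 {R : Type u} [CommRing R] [IsNoetherianRing R]
    (hR : RingFiniteHomologicalDimension R) (X : TopCat.{u})
    (hX : SheafMod.FiniteHomologicalDimension R X)
    (𝒮 : Stratification X) (h𝒮 : 𝒮.IsAcyclic R)
    [HasDerivedCategory.{w₁} (SheafMod.Sh R X)]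
    [HasDerivedCategory.{w₂} (𝒮.RepStrata R)]
    [HasDerivedCategory.{w₃} (𝒮.RepStrataFin R)] :
    ((Stratification.cohomologyPlus 𝒮.weaklyConstructible).ι ⋙
      (𝒮.toRep R).rightDerivedFunctorPlus :
        𝒮.DPlusWC R ⥤ DerivedCategory.Plus (𝒮.RepStrata R)).IsEquivalence ∧
    (∃ E : 𝒮.DBoundedWC R ≌ DerivedCategory.Bounded (𝒮.RepStrata R),
      Nonempty (E.functor ⋙ DerivedCategory.Bounded.ι ≅
        (Stratification.cohomologyBounded 𝒮.weaklyConstructible).ι ⋙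
          Stratification.boundedToPlus R X ⋙
            (𝒮.toRep R).rightDerivedFunctorPlus ⋙ DerivedCategory.Plus.ι)) ∧
    (∃ E : 𝒮.DBoundedC R ≌ DerivedCategory.Bounded (𝒮.RepStrataFin R),
      Nonempty (E.functor ⋙ DerivedCategory.Bounded.ι ⋙
          (QuiverRep.finiteStalks (𝒮.relations R)).ι.mapDerivedCategory ≅
        (Stratification.cohomologyBounded 𝒮.constructible).ι ⋙
          Stratification.boundedToPlus R X ⋙
            (𝒮.toRep R).rightDerivedFunctorPlus ⋙ DerivedCategory.Plus.ι)) :=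
  mainTheorem3_general X 𝒮 h𝒮
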